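/- All graphs are finite partially directed graphs on a vertex set $V$, with at most one edge (directed or undirected) between two distinct vertices and no loops. A v-structure is a triple of distinct vertices with $X\to Y\leftarrow Z$ and $X,Z$ non-adjacent. Two DAGs are Markov equivalent if they have the same d-separation relations. The CPDAG $\mathcal G^*$ of a DAG $\mathcal G$ is the graph without directed cycles that has the skeleton of $\mathcal G$ and in which $X\to Y$ occurs iff it occurs in every DAG equivalent to $\mathcal G$; $[\mathcal G^*]$ denotes the Markov equivalence class of $\mathcal G$. A pairwise causal constraint on $X,Y\in V$ says that $X$ is a parent of $Y$ (direct), that $X$ is an ancestor of $Y$, or that $X$ is not an ancestor of $Y$ (every vertex is an ancestor of itself). For a set $\mathcal B$ of such constraints, $[\mathcal G^*,\mathcal B]$ is the set of DAGs in $[\mathcal G^*]$ that satisfy $\mathcal B$. If it is non-empty, $\mathcal H$ is the MPDAG of $[\mathcal G^*,\mathcal B]$ if $\mathcal H$ has no directed cycle, has the same skeleton and v-structures as $\mathcal G^*$, and contains $X\to Y$ iff all DAGs in $[\mathcal G^*,\mathcal B]$ do. A causal MPDAG is a graph $\mathcal H$ that is the MPDAG of some non-empty $[\mathcal G^*,\mathcal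 B]$; $[\mathcal H]$ denotes the set of DAGs that have the same skeleton and v-structures as $\mathcal H$ and contain all directed edges of $\mathcal H$. **Theorem.** Let $\mathcal H$ be a causal MPDAG. 1. There is exactly one CPDAG $\mathcal G^*$ such that $\mathcal H$ is the MPDAG of $[\mathcal G^*,\mathcal B]$ for some set $\mathcal B$ of pairwise causal constraints with $[\mathcal G^*,\mathcal B]\neq\varnothing$. Call a set $\mathcal A$ of directed edges (read as direct constraints) a *generator* of $\mathcal H$ if $[\mathcal H]=[\mathcal G^*,\mathcal A]$ for this $\mathcal G^*$, and a *minimal generator* if no generator of $\mathcal H$ has fewer elements. 2. There is exactly one pair $(\mathcal G^*,\mathcal B_m)$ of a CPDAG and a minimal generator of $\mathcal H$ such that $[\mathcal H]=[\mathcal G^*,\mathcal B_m]$. 3. The minimal generator of $\mathcal H$ is unique, and a set $\mathcal A$ of directed edges is a minimal generator of $\mathcal H$ if and only if $\mathcal A$ is the set of directed edges of $\mathcal H$ that are not M-strongly protected in $\mathcal H$. Here a directed edge $X\to Y$ of $\mathcal H$ is *M-strongly protected* if it occurs in at least one of the following configurations as an induced subgraph of $\mathcal H$ (all vertices distinct):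 (a) $W\to X\to Y$ with $W,Y$ non-adjacent; (b) $X\to Y\leftarrow W$ with $X,W$ non-adjacent; (c) $X\to W\to Y$ and $X\to Y$; (d) $X-W$, $X-Z$, $W\to Y\leftarrow Z$ and $X\to Y$, with $W,Z$ non-adjacent; (e) $X-W$, $X-Z$, $W\to Z\to Y$ and $X\to Y$, with $W,Y$ non-adjacent. -/

import Mathlib

/-- A partially directed graph on the vertex set `V`: between two distinct vertices there is either
no edge, or one directed edge, or one undirected edge; there are no loops. -/
@[ext]
structure PDGraph (V : Type*) where
  /-- `dir x y` is the directed edge `x → y`. -/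
  dir : V → V → Prop
  /-- `undir x y` is the undirected edge between `x` and `y`. -/
  undir : V → V → Prop
  dir_asymm : ∀ x y, dir x y → ¬ dir y x
  undir_symm : ∀ x y, undir x y → undir y x
  undir_irrefl : ∀ x, ¬ undir x x
  not_undir_of_dir : ∀ x y, dir x y → ¬ undir x y

/-- Pairwise causal constraints with tail `x` and head `y`. -/
inductive CausalConstraint (V : Type*) where
  /-- `x` is a parent of `y`. -/
  | direct (x y : V)
  /-- `x` is an ancestor of `y`. -/
  | ancestral (x y : V)
  /-- `x` is not an ancestor of `y`. -/
  | nonAncestral (x y : V)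

namespace PDGraph

variable {V : Type*}

/-- The skeleton: all arrowheads are removed. -/
def skeleton (G : PDGraph V) : SimpleGraph V where
  Adj x y := G.dir x y ∨ G.dir y x ∨ G.undir x y
  symm := ⟨fun x y h => by
    rcases h with h | h | h
    · exact Or.inr (Or.inl h)
    · exact Or.inl h
    · exact Or.inr (Or.inr (G.undir_symm x y h))⟩
  loopless := ⟨fun x h => by
    rcases h with h | h | h
    · exact G.dir_asymm x x h h
    · exact G.dir_asymm x x h h
    · exact G.undir_irrefl x h⟩

/-- `(x, y, z)` is a v-structure collided on `y`. -/
def IsVStructure (G : PDGraph V) (x y z : V) : Prop :=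
  x ≠ z ∧ G.dir x y ∧ G.dir z y ∧ ¬ G.skeleton.Adj x z

def SameSkeletonAndVStructures (G G' : PDGraph V) : Prop :=
  G.skeleton = G'.skeleton ∧ ∀ x y z, G.IsVStructure x y z ↔ G'.IsVStructure x y z

/-- `x` is an ancestor of `y` (every vertex is an ancestor of itself). -/
def IsAncestor (G : PDGraph V) (x y : V) : Prop :=
  Relation.ReflTransGen G.dir x y

/-- There are no directed cycles, i.e. `G` is a PDAG. -/
def IsPDAG (G : PDGraph V) : Prop :=
  ∀ x, ¬ Relation.TransGen G.dir x x

/-- `G` is a DAG: all edges are directed and there are no directed cycles. -/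
def IsDAG (G : PDGraph V) : Prop :=
  G.IsPDAG ∧ ∀ x y, ¬ G.undir x y

/-! ### d-separation and Markov equivalence -/

/-- The list `p` is a path from `x` to `y`: its vertices are distinct and consecutive vertices are
adjacent. -/
def IsPath (G : PDGraph V) (x y : V) (p : List V) : Prop :=
  p.Nodup ∧ p.IsChain G.skeleton.Adj ∧ p.head? = some x ∧ p.getLast? = some y

/-- The path `p` of a DAG is blocked by `S`: some non-collider of `p` is in `S`, or some collider
of `p` has no descendant (itself included) in `S`. -/
def Blocked (G : PDGraph V) (S : Set V) (p : List V) : Prop :=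
  ∃ a m b, [a, m, b] <:+: p ∧
    (((G.dir m a ∨ G.dir m b) ∧ m ∈ S) ∨
      ((G.dir a m ∧ G.dir b m) ∧ ∀ d, G.IsAncestor m d → d ∉ S))

/-- In the DAG `G`, `S` d-separates `X` from `Y`: it blocks all paths between them. -/
def DSeparated (G : PDGraph V) (X Y S : Set V) : Prop :=
  ∀ x ∈ X, ∀ y ∈ Y, ∀ p, G.IsPath x y p → G.Blocked S p

/-- Markov equivalence of the DAGs `G` and `G'`: they induce the same d-separation relations. -/
def MarkovEquivalent (G G' : PDGraph V) : Prop :=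
  ∀ X Y S : Set V, Disjoint X Y → Disjoint X S → Disjoint Y S →
    (G.DSeparated X Y S ↔ G'.DSeparated X Y S)

/-! ### CPDAGs -/

/-- `C` is the completed PDAG of the DAG `G`. -/
def IsCPDAGOf (C G : PDGraph V) : Prop :=
  C.IsPDAG ∧ C.skeleton = G.skeleton ∧
    ∀ x y, C.dir x y ↔ ∀ G' : PDGraph V, G'.IsDAG → G'.MarkovEquivalent G → G'.dir x y

def IsCPDAG (C : PDGraph V) : Prop :=
  ∃ G : PDGraph V, G.IsDAG ∧ C.IsCPDAGOf G

/-- The Markov equivalence class `[C]` represented by the CPDAG `C`. -/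
def markovClass (C : PDGraph V) : Set (PDGraph V) :=
  {D | D.IsDAG ∧ ∃ G : PDGraph V, G.IsDAG ∧ C.IsCPDAGOf G ∧ D.MarkovEquivalent G}

/-! ### Background knowledge and causal MPDAGs -/

/-- The DAG `D` satisfies the constraint. -/
def Satisfies (D : PDGraph V) : CausalConstraint V → Prop
  | .direct x y => D.dir x y
  | .ancestral x y => D.IsAncestor x y
  | .nonAncestral x y => ¬ D.IsAncestor x y

/-- The restricted Markov equivalence class `[C, B]`. -/
def restrictedClass (C : PDGraph V) (B : Set (CausalConstraint V)) : Set (PDGraph V) :=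
  {D | D ∈ C.markovClass ∧ ∀ c ∈ B, D.Satisfies c}

/-- `H` is the MPDAG of the non-empty restricted Markov equivalence class `[C, B]`. -/
def IsMPDAGOf (H C : PDGraph V) (B : Set (CausalConstraint V)) : Prop :=
  (C.restrictedClass B).Nonempty ∧ H.IsPDAG ∧ H.SameSkeletonAndVStructures C ∧
    ∀ x y, H.dir x y ↔ ∀ D ∈ C.restrictedClass B, D.dir x y

/-- `C` is a CPDAG that induces, with some set of pairwise causal constraints, a restricted Markov
equivalence class whose MPDAG is `H`. -/
def IsUnderlyingCPDAG (C H : PDGraph V) : Prop :=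
  C.IsCPDAG ∧ ∃ B : Set (CausalConstraint V), H.IsMPDAGOf C B

def IsCausalMPDAG (H : PDGraph V) : Prop :=
  ∃ C : PDGraph V, C.IsUnderlyingCPDAG H

/-- `[H]`: the DAGs that contain all directed edges of `H` and have the same skeleton and
v-structures as `H`. -/
def dagClass (H : PDGraph V) : Set (PDGraph V) :=
  {D | D.IsDAG ∧ D.SameSkeletonAndVStructures H ∧ ∀ x y, H.dir x y → D.dir x y}

/-! ### Generators -/

/-- A set of directed edges, read as a set of direct causal constraints. -/
def directConstraints (A : Set (V × V)) : Set (CausalConstraint V) :=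
  (fun e => CausalConstraint.direct e.1 e.2) '' A

/-- `[H] = [C, A]`, where `C` is the CPDAG of the restricted Markov equivalence classes represented
by `H`. -/
def IsGenerator (H : PDGraph V) (A : Set (V × V)) : Prop :=
  ∃ C : PDGraph V, C.IsUnderlyingCPDAG H ∧ H.dagClass = C.restrictedClass (directConstraints A)

/-- A generator with the least number of direct causal constraints. -/
def IsMinimalGenerator (H : PDGraph V) (A : Set (V × V)) : Prop :=
  H.IsGenerator A ∧ ∀ A' : Set (V × V), H.IsGenerator A' → A.encard ≤ A'.encard

/-- The directed edge `x → y` occurs in one of the five configurations as an induced subgraph. -/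
def MStronglyProtected (H : PDGraph V) (x y : V) : Prop :=
  H.dir x y ∧
    ((∃ w, H.dir w x ∧ ¬ H.skeleton.Adj w y) ∨
     (∃ w, w ≠ x ∧ H.dir w y ∧ ¬ H.skeleton.Adj w x) ∨
     (∃ w, H.dir x w ∧ H.dir w y) ∨
     (∃ w z, w ≠ z ∧ H.undir x w ∧ H.undir x z ∧ H.dir w y ∧ H.dir z y ∧
        ¬ H.skeleton.Adj w z) ∨
     (∃ w z, H.undir x w ∧ H.undir x z ∧ H.dir w z ∧ H.dir z y ∧ ¬ H.skeleton.Adj w y))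

end PDGraph

namespace PDGraph

variable {V : Type*} {G G' C C' D H : PDGraph V}

/-! ### Basic facts -/

/-! Two facts carry the proof. The first is the Verma–Pearl criterion: DAGs are Markov equivalent
iff they share skeleton and v-structures. Non-adjacent `x`, `y` with `x` no ancestor of `y` are
d-separated by the parents of `x`, which recovers skeleton and v-structures
(`MarkovEquivalent.sameSkeletonAndVStructures`). Conversely, reversals of covered edges
(`exists_isCovered`) turn one DAG into the other, and each preserves the existence of active walks
(`ActiveWalk.flipInvariant`). So a CPDAG is determined by its skeleton and v-structures, whence the
uniqueness of the underlying CPDAG.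

The second is that the unprotected edges form the least generator. They generate: if a DAG with the
skeleton and v-structures of `H` contains them but misses a directed edge of `H`, then at a suitably
chosen missing edge each protecting configuration forces a directed cycle or a change of
v-structures (`IsMaximallyOriented.dir_of_unprotectedEdges`). They lie in every generator: an
unprotected edge is covered in some DAG of `[H]`, and reversing it there violates this one edge of
`H` and nothing else (`IsUnderlyingCPDAG.unprotectedEdges_subset`).

The hard part is to make the edge `x → y` covered (`IsMaximallyOriented.exists_isExt_isCovered`).
For this the parents of `x` among its undirected neighbours are prescribed
(`IsMaximallyOriented.exists_isExt_of_clique`); the absence of configurations (d) and (e) supplies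
the hypotheses. Consistent extensions are built by induction, removing a vertex that can come last
and putting it back. -/

theorem adj_of_dir {x y : V} (h : G.dir x y) : G.skeleton.Adj x y := Or.inl h

theorem adj_of_dir' {x y : V} (h : G.dir x y) : G.skeleton.Adj y x := Or.inr (Or.inl h)

theorem adj_of_undir {x y : V} (h : G.undir x y) : G.skeleton.Adj x y := Or.inr (Or.inr h)

theorem IsDAG.dir_or_dir (hG : G.IsDAG) {x y : V} (h : G.skeleton.Adj x y) :
    G.dir x y ∨ G.dir y x := by
  rcases h with h | h | h
  · exact Or.inl h
  · exact Or.inr h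
  · exact absurd h (hG.2 x y)

theorem ne_of_dir {x y : V} (h : G.dir x y) : x ≠ y := (adj_of_dir h).ne

/-- The edges of a finite acyclic graph increase along some numbering of the vertices. -/
theorem IsPDAG.exists_rank [Finite V] (hG : G.IsPDAG) :
    ∃ f : V → ℕ, ∀ a b, G.dir a b → f a < f b := by
  -- The rank counts proper ancestors; along `a → b` at least `a` itself is gained.
  refine ⟨fun a => {z | Relation.TransGen G.dir z a}.ncard, fun a b hab => ?_⟩
  refine Set.ncard_lt_ncard ⟨fun z hz => Relation.TransGen.tail hz hab, fun h => ?_⟩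
    (Set.toFinite _)
  exact hG a (h (Relation.TransGen.single hab))

theorem IsPDAG.of_rank {f : V → ℕ} (hf : ∀ a b, G.dir a b → f a < f b) : G.IsPDAG := by
  intro x hx
  have key : ∀ y, Relation.TransGen G.dir x y → f x < f y := by
    intro y hy
    induction hy with
    | single h => exact hf _ _ h
    | tail _ h ih => exact ih.trans (hf _ _ h)
  exact lt_irrefl _ (key x hx)

/-! ### Markov equivalence determines the skeleton and the v-structures -/

theorem MarkovEquivalent.refl (G : PDGraph V) : G.MarkovEquivalent G :=
  fun _ _ _ _ _ _ => Iff.rfl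

theorem MarkovEquivalent.symm (h : G.MarkovEquivalent G') : G'.MarkovEquivalent G :=
  fun X Y S h1 h2 h3 => (h X Y S h1 h2 h3).symm

theorem MarkovEquivalent.trans {G'' : PDGraph V} (h : G.MarkovEquivalent G')
    (h' : G'.MarkovEquivalent G'') : G.MarkovEquivalent G'' :=
  fun X Y S h1 h2 h3 => (h X Y S h1 h2 h3).trans (h' X Y S h1 h2 h3)

theorem not_dSeparated_of_adj {x y : V} (h : G.skeleton.Adj x y) (S : Set V) :
    ¬ G.DSeparated {x} {y} S := by
  intro hd
  obtain ⟨a, m, b, hp, -⟩ := hd x rfl y rfl [x, y] ⟨by simpa using h.ne, by simpa using h, rfl, rfl⟩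
  have := hp.length_le
  simp at this

/-- A path that leaves an ancestor of `c` and ends in a vertex without the ancestor `c` contains a
collider with the ancestor `c`. -/
theorem exists_collider (hG : G.IsDAG) {c y : V} (hy : ¬ G.IsAncestor c y) :
    ∀ (l : List V) (a m : V), (a :: m :: l).IsChain G.skeleton.Adj →
      (a :: m :: l).getLast? = some y → G.dir a m → G.IsAncestor c m →
      ∃ u v w, [u, v, w] <:+: (a :: m :: l) ∧ G.dir u v ∧ G.dir w v ∧ G.IsAncestor c v := by
  intro l
  induction l with
  | nil =>
    intro a m _ hl _ hc
    simp at hl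
    exact absurd (hl ▸ hc) hy
  | cons b l ih =>
    intro a m hch hl ham hc
    rw [List.isChain_cons_cons, List.isChain_cons_cons] at hch
    rcases hG.dir_or_dir hch.2.1 with h | h
    · obtain ⟨u, v, w, hi, h'⟩ := ih m b (List.isChain_cons_cons.2 hch.2)
        (by simpa using hl) h (Relation.ReflTransGen.tail hc h)
      exact ⟨u, v, w, hi.trans (List.suffix_cons _ _).isInfix, h'⟩
    · exact ⟨a, m, b, ⟨[], l, by simp⟩, ham, h, hc⟩

/-- A path that leaves `x` through a parent is blocked by that parent, a non-collider. A path that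
leaves `x` downwards cannot stay directed up to `y`, so it has a collider below `x`; by acyclicity
no descendant of that collider is a parent of `x`. -/
theorem dSeparated_parents (hG : G.IsDAG) {x y : V} (hne : x ≠ y) (hadj : ¬ G.skeleton.Adj x y)
    (hanc : ¬ G.IsAncestor x y) : G.DSeparated {x} {y} {z | G.dir z x} := by
  rintro _ rfl _ rfl p ⟨-, hch, hh, hl⟩
  match p, hch, hh, hl with
  | [], _, hh, _ => simp at hh
  | [a], _, hh, hl =>
    simp at hh hl
    exact absurd (hh.symm.trans hl) hne
  | [a, b], hch, hh, hl =>
    simp at hh hl hch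
    subst hh hl
    exact absurd hch hadj
  | a :: q :: r :: l, hch, hh, hl =>
    simp at hh
    subst hh
    have hch' := hch
    rw [List.isChain_cons_cons] at hch'
    rcases hG.dir_or_dir hch'.1 with h | h
    · obtain ⟨u, v, w, hi, huv, hwv, hav⟩ := exists_collider hG hanc (r :: l) a q hch hl h
        (Relation.ReflTransGen.single h)
      refine ⟨u, v, w, hi, Or.inr ⟨⟨huv, hwv⟩, fun d hd hda => ?_⟩⟩
      exact hG.1 a (Relation.TransGen.tail' (Relation.ReflTransGen.trans hav hd) hda)
    · exact ⟨a, q, r, ⟨[], l, by simp⟩, Or.inl ⟨Or.inl h, h⟩⟩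

theorem IsDAG.not_isAncestor_or (hG : G.IsDAG) {x y : V} (hne : x ≠ y) :
    ¬ G.IsAncestor x y ∨ ¬ G.IsAncestor y x := by
  by_contra! h
  rcases Relation.reflTransGen_iff_eq_or_transGen.1 h.1 with h1 | h1
  · exact hne h1.symm
  · exact hG.1 x (Relation.TransGen.trans_left h1 h.2)

theorem MarkovEquivalent.dSeparated_parents (h : G.MarkovEquivalent G') (hG : G.IsDAG) {x y : V}
    (hne : x ≠ y) (hadj : ¬ G.skeleton.Adj x y) (hanc : ¬ G.IsAncestor x y) :
    G'.DSeparated {x} {y} {z | G.dir z x} := by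
  refine (h {x} {y} _ ?_ ?_ ?_).1 (PDGraph.dSeparated_parents hG hne hadj hanc)
  · simpa using hne
  · simpa using fun h => G.dir_asymm _ _ h h
  · simpa using fun h => hadj (adj_of_dir' h)

theorem MarkovEquivalent.adj_of_adj (h : G.MarkovEquivalent G') (hG : G.IsDAG) {x y : V}
    (hadj : G'.skeleton.Adj x y) : G.skeleton.Adj x y := by
  by_contra hn
  rcases hG.not_isAncestor_or hadj.ne with ha | ha
  · exact not_dSeparated_of_adj hadj _ (h.dSeparated_parents hG hadj.ne hn ha)
  · exact not_dSeparated_of_adj hadj.symm _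
      (h.dSeparated_parents hG hadj.ne.symm (fun h => hn h.symm) ha)

theorem MarkovEquivalent.skeleton_eq (h : G.MarkovEquivalent G') (hG : G.IsDAG)
    (hG' : G'.IsDAG) : G.skeleton = G'.skeleton := by
  ext x y
  exact ⟨h.symm.adj_of_adj hG', h.adj_of_adj hG⟩

theorem IsVStructure.symm {x y z : V} (h : G.IsVStructure x y z) : G.IsVStructure z y x :=
  ⟨h.1.symm, h.2.2.1, h.2.1, fun h' => h.2.2.2 h'.symm⟩

/-- The parents of `x` in `G` also block the path `x, z, y` in `G'`. Since `x → z` in `G`, the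
vertex `z` is not among them, so it can only block as a collider. -/
theorem MarkovEquivalent.isVStructure (h : G.MarkovEquivalent G') (hG : G.IsDAG)
    (hG' : G'.IsDAG) {x z y : V} (hv : G.IsVStructure x z y) : G'.IsVStructure x z y := by
  wlog ha : ¬ G.IsAncestor x y generalizing x y
  · exact (this hv.symm ((hG.not_isAncestor_or hv.1).resolve_left ha)).symm
  obtain ⟨hne, hxz, hyz, hn⟩ := hv
  have hs := h.skeleton_eq hG hG'
  obtain ⟨a, m, b, hi, hb⟩ := h.dSeparated_parents hG hne hn ha x rfl y rfl [x, z, y]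
    ⟨by simp [hne, ne_of_dir hxz, (ne_of_dir hyz).symm],
      by simpa [← hs] using ⟨adj_of_dir hxz, adj_of_dir' hyz⟩, rfl, rfl⟩
  have he := hi.eq_of_length rfl
  simp only [List.cons.injEq, and_true] at he
  obtain ⟨rfl, rfl, rfl⟩ := he
  rcases hb with hb | hb
  · exact absurd hb.2 (G.dir_asymm _ _ hxz)
  · exact ⟨hne, hb.1.1, hb.1.2, hs ▸ hn⟩

theorem MarkovEquivalent.sameSkeletonAndVStructures (h : G.MarkovEquivalent G') (hG : G.IsDAG)
    (hG' : G'.IsDAG) : G.SameSkeletonAndVStructures G' :=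
  ⟨h.skeleton_eq hG hG', fun _ _ _ => ⟨h.isVStructure hG hG', h.symm.isVStructure hG' hG⟩⟩

/-! ### Active walks -/

/-- `ActiveWalk G S a m v`: some walk from `a` to `v` has its colliders in `S` and its non-colliders
outside `S`; its last edge points into `v` iff `m` is true. -/
inductive ActiveWalk (G : PDGraph V) (S : Set V) (a : V) : Bool → V → Prop
  | start : ActiveWalk G S a false a
  | up {v u : V} : ActiveWalk G S a false v → v ∉ S → G.dir u v → ActiveWalk G S a false u
  | down {m : Bool} {v w : V} : ActiveWalk G S a m v → v ∉ S → G.dir v w → ActiveWalk G S a true w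
  | bounce {v u : V} : ActiveWalk G S a true v → v ∈ S → G.dir u v → ActiveWalk G S a false u

/-- The walk goes down to the descendant in `S`, bounces and comes back up. This is why it suffices
to ask for colliders in `S` itself when walks replace paths. -/
theorem ActiveWalk.false_of_descendant {S : Set V} {a v d : V} (h : ActiveWalk G S a true v)
    (hd : G.IsAncestor v d) (hdS : d ∈ S) : v ∈ S ∨ ActiveWalk G S a false v := by
  induction hd using Relation.ReflTransGen.head_induction_on with
  | refl => exact Or.inl hdS
  | head hvc _ ih =>
    rename_i v c _
    by_cases hv : v ∈ S
    · exact Or.inl hv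
    have hc := ActiveWalk.down h hv hvc
    by_cases hcS : c ∈ S
    · exact Or.inr (.bounce hc hcS hvc)
    · exact Or.inr (.up ((ih hc).resolve_left hcS) hcS hvc)

theorem Blocked.of_infix {S : Set V} {p q : List V} (h : G.Blocked S p) (hpq : p <:+: q) :
    G.Blocked S q := by
  obtain ⟨a, m, b, hi, hb⟩ := h
  exact ⟨a, m, b, hi.trans hpq, hb⟩

theorem not_blocked_triple {S : Set V} {p : List V} (h : ¬ G.Blocked S p) {a m b : V}
    (hi : [a, m, b] <:+: p) : (m ∈ S → ¬ G.dir m a ∧ ¬ G.dir m b) ∧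
      (G.dir a m → G.dir b m → ∃ d, G.IsAncestor m d ∧ d ∈ S) := by
  constructor
  · intro hm
    constructor <;> intro hd
    · exact h ⟨a, m, b, hi, Or.inl ⟨Or.inl hd, hm⟩⟩
    · exact h ⟨a, m, b, hi, Or.inl ⟨Or.inr hd, hm⟩⟩
  · intro h1 h2
    by_contra! hc
    exact h ⟨a, m, b, hi, Or.inr ⟨⟨h1, h2⟩, hc⟩⟩

/-- The first edge of the list `v :: l` points into `v`. -/
def PointsIn (G : PDGraph V) (v : V) (l : List V) : Prop := ∃ u ∈ l.head?, G.dir u v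

/-- The path is read from its far end `y`. The flag `m` records whether the edge just used points
into `v`; a collider outside `S` is handled by a detour to its descendant in `S`. -/
theorem activeWalk_of_not_blocked (hG : G.IsDAG) {S : Set V} {y : V} (hy : y ∉ S) :
    ∀ (l : List V) (v : V), (v :: l).IsChain G.skeleton.Adj → (v :: l).getLast? = some y →
      ¬ G.Blocked S (v :: l) →
      ∃ m, ActiveWalk G S y m v ∧ (m = true ↔ G.PointsIn v l) ∧ (l = [] → v = y) := by
  intro l
  induction l with
  | nil =>
    intro v _ hl _
    simp at hl
    subst hl
    exact ⟨false, .start, by simp [PointsIn], fun _ => rfl⟩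
  | cons v l ih =>
    intro b hch hl hb
    rw [List.isChain_cons_cons] at hch
    obtain ⟨m, hm, hmd, hle⟩ := ih v hch.2 (by simpa using hl)
      (fun h => hb (h.of_infix (List.suffix_cons _ _).isInfix))
    have hvS : G.dir v b → v ∉ S := by
      intro hvb hvS
      rcases l with _ | ⟨u, l⟩
      · exact hy (hle rfl ▸ hvS)
      · exact ((not_blocked_triple hb (a := b) (m := v) (b := u) ⟨[], l, by simp⟩).1 hvS).1 hvb
    rcases hG.dir_or_dir hch.1 with h | h
    · refine ⟨false, ?_, by simpa [PointsIn] using G.dir_asymm _ _ h, by simp⟩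
      rcases m with _ | _
      · by_cases hvS' : v ∈ S
        · exfalso
          rcases l with _ | ⟨u, l⟩
          · exact hy (hle rfl ▸ hvS')
          · have huv : ¬ G.dir u v := fun h' => by
              have := hmd.2 ⟨u, by simp, h'⟩
              simp at this
            exact ((not_blocked_triple hb (a := b) (m := v) (b := u) ⟨[], l, by simp⟩).1 hvS').2
              ((hG.dir_or_dir (List.isChain_cons_cons.1 hch.2).1).resolve_right huv)
        · exact .up hm hvS' h
      · obtain ⟨u, hu, huv⟩ := hmd.1 rfl
        rcases l with _ | ⟨u', l⟩
        · simp at hu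
        simp at hu
        subst hu
        obtain ⟨d, hd, hdS⟩ := (not_blocked_triple hb (a := b) (m := v) (b := u')
          ⟨[], l, by simp⟩).2 h huv
        by_cases hvS' : v ∈ S
        · exact .bounce hm hvS' h
        · exact .up ((hm.false_of_descendant hd hdS).resolve_left hvS') hvS' h
    · exact ⟨true, .down hm (hvS h) h, by simpa [PointsIn] using h, by simp⟩

/-- A path from `v` to `a`, with vertices `v :: l`, that is not blocked by `S`. -/
def OpenPath (G : PDGraph V) (S : Set V) (a v : V) (l : List V) : Prop :=
  G.IsPath v a (v :: l) ∧ ¬ G.Blocked S (v :: l)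

/-- Read backwards from `w`: either the preceding edge also points into `w`, which is then a
collider of an open path, or `w` points to its predecessor and the argument repeats there, at the
latest ending at `c`. It is needed when a path is cut at `w`. -/
theorem exists_descendant_of_collider (hG : G.IsDAG) {S : Set V} {w u : V} (l₂ : List V)
    (huw : G.dir u w) :
    ∀ (r : List V) (c : V), (c :: (r ++ w :: u :: l₂)).IsChain G.skeleton.Adj →
      ¬ G.Blocked S (c :: (r ++ w :: u :: l₂)) →
      (G.PointsIn c (r ++ w :: u :: l₂) → ∃ d, G.IsAncestor c d ∧ d ∈ S) →
      ∃ d, G.IsAncestor w d ∧ d ∈ S := by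
  intro r
  induction r with
  | nil =>
    intro c hch hb hc
    rw [List.nil_append, List.isChain_cons_cons] at hch
    rcases hG.dir_or_dir hch.1 with h | h
    · exact (not_blocked_triple hb (a := c) (m := w) (b := u) ⟨[], l₂, by simp⟩).2 h huw
    · obtain ⟨d, hd, hdS⟩ := hc ⟨w, by simp, h⟩
      exact ⟨d, Relation.ReflTransGen.head h hd, hdS⟩
  | cons e r ih =>
    intro c hch hb hc
    rw [List.cons_append, List.isChain_cons_cons] at hch
    refine ih e hch.2 (fun h => hb (h.of_infix (List.suffix_cons _ _).isInfix)) ?_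
    rintro ⟨f, hf, hfe⟩
    rcases hG.dir_or_dir hch.1 with h | h
    · obtain ⟨t, ht⟩ : ∃ t, r ++ w :: u :: l₂ = f :: t := List.head?_eq_some_iff.1 hf
      exact (not_blocked_triple hb (a := c) (m := e) (b := f)
        ⟨[], t, by simp [ht]⟩).2 h hfe
    · obtain ⟨d, hd, hdS⟩ := hc ⟨e, by simp, h⟩
      exact ⟨d, Relation.ReflTransGen.head h hd, hdS⟩

/-- One step of the conversion of an active walk to an open path: the path `v :: l` is extended by
the edge between `v` and `w`, or cut off at `w`. -/
theorem OpenPath.step (hG : G.IsDAG) {S : Set V} {a v w : V} {l : List V} (ha : a ∉ S)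
    (hp : G.OpenPath S a v l) (hadj : G.skeleton.Adj w v)
    (hS : v ∈ S → G.dir w v ∧ G.PointsIn v l)
    (hin : G.dir w v → G.PointsIn v l → ∃ d, G.IsAncestor v d ∧ d ∈ S) :
    ∃ l', G.OpenPath S a w l' ∧ (G.dir v w → w ∈ S → G.PointsIn w l') ∧
      (G.dir w v → w ∈ S ∨ (G.PointsIn w l' → ∃ d, G.IsAncestor w d ∧ d ∈ S)) := by
  obtain ⟨⟨hnd, hch, -, hl⟩, hb⟩ := hp
  by_cases hw : w ∈ v :: l
  · have hwl : w ∈ l := by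
      rcases List.mem_cons.1 hw with h | h
      · exact absurd h hadj.ne
      · exact h
    obtain ⟨r, l', rfl⟩ := List.append_of_mem hwl
    have hsuf : (w :: l') <:+ v :: (r ++ w :: l') := ⟨v :: r, by simp⟩
    refine ⟨l', ⟨⟨hnd.sublist hsuf.sublist, hch.suffix hsuf, rfl, ?_⟩,
      fun h => hb (h.of_infix hsuf.isInfix)⟩, ?_, ?_⟩
    · rw [← hl, ← List.cons_append, List.getLast?_append_cons]
    · intro _ hwS
      rcases l' with _ | ⟨u, l'⟩
      · rw [← List.cons_append, List.getLast?_append_cons] at hl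
        simp at hl
        exact absurd (hl ▸ hwS) ha
      · have hwu : G.skeleton.Adj w u := (List.isChain_cons_cons.1 (hch.suffix hsuf)).1
        -- Before the cut `w` was an inner vertex of an open path; lying in `S`, it has to be a
        -- collider there.
        refine ⟨u, by simp, (hG.dir_or_dir hwu).resolve_left ?_⟩
        obtain ⟨t, b, ht⟩ : ∃ t b, v :: r = t ++ [b] :=
          ⟨_, _, (List.dropLast_append_getLast (List.cons_ne_nil v r)).symm⟩
        refine ((not_blocked_triple hb (a := b) (m := w) (b := u) ⟨t, l', ?_⟩).1 hwS).2
        rw [← List.cons_append, ht]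
        simp
    · intro hwv
      right
      rintro ⟨u, hu, huw⟩
      obtain ⟨t, rfl⟩ : ∃ t, l' = u :: t := List.head?_eq_some_iff.1 hu
      exact exists_descendant_of_collider hG t huw r v hch hb (hin hwv)
  · refine ⟨v :: l, ⟨⟨List.nodup_cons.2 ⟨hw, hnd⟩, List.isChain_cons_cons.2 ⟨hadj, hch⟩, rfl,
      by simpa using hl⟩, ?_⟩, ?_, ?_⟩
    · rintro ⟨p, m, q, ⟨s, t, hst⟩, hpq⟩
      rcases s with _ | ⟨s0, s⟩
      · simp only [List.nil_append, List.cons_append, List.cons.injEq] at hst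
        obtain ⟨rfl, rfl, rfl⟩ := hst
        rcases hpq with ⟨h1, h2⟩ | ⟨⟨h1, h2⟩, h3⟩
        · obtain ⟨h4, u, hu, h5⟩ := hS h2
          simp at hu
          subst hu
          exact h1.elim (G.dir_asymm _ _ h4) (G.dir_asymm _ _ h5)
        · obtain ⟨d, hd, hdS⟩ := hin h1 ⟨q, by simp, h2⟩
          exact h3 d hd hdS
      · simp only [List.cons_append, List.cons.injEq] at hst
        exact hb ⟨p, m, q, ⟨s, t, by simpa using hst.2⟩, hpq⟩
    · exact fun h _ => ⟨v, by simp, h⟩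
    · intro h
      right
      rintro ⟨u, hu, h'⟩
      simp at hu
      subst hu
      exact absurd h' (G.dir_asymm _ _ h)

/-- Cutting loops may change the direction of the last edge, so the path only keeps what the next
step needs: an edge into `v` if the walk may bounce there, and a descendant in `S` if leaving `v`
upwards would make it a collider. A walk with `m = false` and `v ∈ S` cannot be continued. -/
theorem ActiveWalk.exists_openPath (hG : G.IsDAG) {S : Set V} {a v : V} {m : Bool} (ha : a ∉ S)
    (h : G.ActiveWalk S a m v) :
    (m = false ∧ v ∈ S) ∨ ∃ l, G.OpenPath S a v l ∧ (m = true → v ∈ S → G.PointsIn v l) ∧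
      (m = false → G.PointsIn v l → ∃ d, G.IsAncestor v d ∧ d ∈ S) := by
  induction h with
  | start =>
    refine Or.inr ⟨[], ⟨⟨by simp, by simp, rfl, rfl⟩, ?_⟩, by simp, by simp [PointsIn]⟩
    rintro ⟨p, m, q, hi, -⟩
    have := hi.length_le
    simp at this
  | up _ hv huv ih =>
    obtain ⟨l, hp, -, h2⟩ := ih.resolve_left (fun h => hv h.2)
    obtain ⟨l', hp', -, h4⟩ := hp.step hG ha (adj_of_dir huv) (fun h => absurd h hv)
      (fun _ => h2 rfl)
    rcases h4 huv with h4 | h4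
    · exact Or.inl ⟨rfl, h4⟩
    · exact Or.inr ⟨l', hp', by simp, fun _ => h4⟩
  | down _ hv hvw ih =>
    obtain ⟨l, hp, -⟩ := ih.resolve_left (fun h => hv h.2)
    obtain ⟨l', hp', h3, -⟩ := hp.step hG ha (adj_of_dir' hvw) (fun h => absurd h hv)
      (fun h => absurd h (G.dir_asymm _ _ hvw))
    exact Or.inr ⟨l', hp', fun _ => h3 hvw, by simp⟩
  | bounce _ hv huv ih =>
    obtain ⟨l, hp, h1, -⟩ := ih.resolve_left (by simp)
    obtain ⟨l', hp', -, h4⟩ := hp.step hG ha (adj_of_dir huv) (fun h => ⟨huv, h1 rfl h⟩)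
      (fun _ _ => ⟨_, Relation.ReflTransGen.refl, hv⟩)
    rcases h4 huv with h4 | h4
    · exact Or.inl ⟨rfl, h4⟩
    · exact Or.inr ⟨l', hp', by simp, fun _ => h4⟩

theorem not_dSeparated_singleton_iff (hG : G.IsDAG) {S : Set V} {x y : V} (hx : x ∉ S)
    (hy : y ∉ S) : ¬ G.DSeparated {x} {y} S ↔ ∃ m, G.ActiveWalk S y m x := by
  constructor
  · intro h
    simp only [DSeparated, Set.mem_singleton_iff, forall_eq, not_forall] at h
    obtain ⟨p, ⟨-, hch, hh, hl⟩, hb⟩ := h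
    obtain ⟨l, rfl⟩ := List.head?_eq_some_iff.1 hh
    obtain ⟨m, hm, -⟩ := activeWalk_of_not_blocked hG hy l x hch hl hb
    exact ⟨m, hm⟩
  · rintro ⟨m, hm⟩ h
    obtain ⟨l, hp, -⟩ := (hm.exists_openPath hG hy).resolve_left (fun h => hx h.2)
    exact hp.2 (h x rfl y rfl _ hp.1)

theorem dSeparated_iff_singleton {X Y S : Set V} :
    G.DSeparated X Y S ↔ ∀ x ∈ X, ∀ y ∈ Y, G.DSeparated {x} {y} S := by
  simp [DSeparated]

/-! ### Reversing a covered edge preserves active walks -/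

/-- What an active walk in `G` yields in the graph `G'` in which `x → y` is reversed. -/
def FlipInvariant (G' : PDGraph V) (S : Set V) (a x y : V) (m : Bool) (v : V) : Prop :=
  (v ≠ x → v ≠ y → G'.ActiveWalk S a m v) ∧
  (v = x → m = true → G'.ActiveWalk S a true x ∧ G'.ActiveWalk S a true y) ∧
  (v = x → m = false → G'.ActiveWalk S a false x ∨ (y ∉ S ∧ G'.ActiveWalk S a false y) ∨
    (y ∈ S ∧ G'.ActiveWalk S a true x ∧ G'.ActiveWalk S a true y)) ∧
  (v = y → m = true → (G'.ActiveWalk S a true x ∧ G'.ActiveWalk S a true y) ∨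
    (x ∉ S ∧ G'.ActiveWalk S a false x) ∨ (y ∉ S ∧ G'.ActiveWalk S a false y)) ∧
  (v = y → m = false → G'.ActiveWalk S a false y)

theorem FlipInvariant.of_false {S : Set V} {a x y v : V} (h : G'.ActiveWalk S a false v) :
    G'.FlipInvariant S a x y false v := by
  refine ⟨fun _ _ => h, by simp, ?_, by simp, ?_⟩
  · rintro rfl _; exact Or.inl h
  · rintro rfl _; exact h

theorem FlipInvariant.exists_activeWalk {S : Set V} {a x y v : V} {m : Bool}
    (hyx : G'.dir y x) (h : G'.FlipInvariant S a x y m v) :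
    ∃ m', G'.ActiveWalk S a m' v := by
  obtain ⟨h1, h2, h3, h4, h5⟩ := h
  by_cases hx : v = x
  · subst hx
    rcases m with _ | _
    · rcases h3 rfl rfl with h | ⟨h, h'⟩ | h
      · exact ⟨_, h⟩
      · exact ⟨_, .down h' h hyx⟩
      · exact ⟨_, h.2.1⟩
    · exact ⟨_, (h2 rfl rfl).1⟩
  by_cases hy : v = y
  · subst hy
    rcases m with _ | _
    · exact ⟨_, h5 rfl rfl⟩
    · rcases h4 rfl rfl with h | ⟨h, h'⟩ | h
      · exact ⟨_, h.2⟩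
      · exact ⟨_, .up h' h hyx⟩
      · exact ⟨_, h.2⟩
  exact ⟨_, h1 hx hy⟩

/-- As `x` and `y` have the same other parents, a walk that enters one of them from such a parent
can enter the other as well, and can leave either of them towards such a parent. A step along the
reversed edge itself is postponed: the new walk waits at the other end, which accounts for the
alternatives in `FlipInvariant`. -/
theorem ActiveWalk.flipInvariant {S : Set V} {a x y v : V} {m : Bool} (hxy : G.dir x y)
    (hcov : ∀ z, z ≠ x → (G.dir z y ↔ G.dir z x)) (hyx : G'.dir y x)
    (hkeep : ∀ u w, G.dir u w → ¬ (u = x ∧ w = y) → G'.dir u w) (h : G.ActiveWalk S a m v) :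
    G'.FlipInvariant S a x y m v := by
  have hne : x ≠ y := ne_of_dir hxy
  have hpx : ∀ p, G.dir p x → G'.dir p x ∧ G'.dir p y := fun p hp =>
    ⟨hkeep _ _ hp fun h => hne h.2,
      hkeep _ _ ((hcov p (ne_of_dir hp)).2 hp) fun h => ne_of_dir hp h.1⟩
  induction h with
  | start => exact .of_false .start
  | @up v u _ hv huv ih =>
    have ih' := ih
    obtain ⟨h1, -, h3, -, h5⟩ := ih
    by_cases hvx : v = x
    · subst hvx
      rcases h3 rfl rfl with h | ⟨h, h'⟩ | ⟨h, -, h'⟩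
      · exact .of_false (.up h hv (hpx u huv).1)
      · exact .of_false (.up h' h (hpx u huv).2)
      · exact .of_false (.bounce h' h (hpx u huv).2)
    by_cases hvy : v = y
    · subst hvy
      by_cases hux : u = x
      · subst hux
        exact ⟨fun h => absurd rfl h, by simp, fun _ _ => Or.inr (Or.inl ⟨hv, h5 rfl rfl⟩),
          fun h => absurd h hne, fun h => absurd h hne⟩
      · exact .of_false (.up (h5 rfl rfl) hv (hkeep _ _ huv fun h => hux h.1))
    exact .of_false (.up (h1 hvx hvy) hv (hkeep _ _ huv fun h => hvy h.2))
  | @down m v w _ hv hvw ih =>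
    obtain ⟨m', hm'⟩ := ih.exists_activeWalk hyx
    obtain ⟨-, h2, h3, -, -⟩ := ih
    refine ⟨fun hwx hwy => .down hm' hv (hkeep _ _ hvw fun h => hwy h.2), ?_, by simp, ?_, by simp⟩
    · rintro rfl _
      exact ⟨.down hm' hv (hpx _ hvw).1, .down hm' hv (hpx _ hvw).2⟩
    · rintro rfl _
      by_cases hvx : v = x
      · subst hvx
        rcases m with _ | _
        · rcases h3 rfl rfl with h | h | h
          · exact Or.inr (Or.inl ⟨hv, h⟩)
          · exact Or.inr (Or.inr h)
          · exact Or.inl h.2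
        · exact Or.inl (h2 rfl rfl)
      · have := hpx _ ((hcov v hvx).1 hvw)
        exact Or.inl ⟨.down hm' hv this.1, .down hm' hv this.2⟩
  | @bounce v u _ hv huv ih =>
    obtain ⟨h1, h2, -, h4, -⟩ := ih
    by_cases hvx : v = x
    · subst hvx
      exact .of_false (.bounce (h2 rfl rfl).1 hv (hpx u huv).1)
    by_cases hvy : v = y
    · subst hvy
      by_cases hux : u = x
      · subst hux
        rcases h4 rfl rfl with h | h | h
        · exact ⟨fun h => absurd rfl h, by simp, fun _ _ => Or.inr (Or.inr ⟨hv, h⟩),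
            fun h => absurd h hne, fun h => absurd h hne⟩
        · exact .of_false h.2
        · exact absurd hv h.1
      · have hu := hpx u ((hcov u hux).1 huv)
        rcases h4 rfl rfl with h | h | h
        · exact .of_false (.bounce h.2 hv hu.2)
        · exact .of_false (.up h.2 h.1 hu.1)
        · exact absurd hv h.1
    exact .of_false (.bounce (h1 hvx hvy) hv (hkeep _ _ huv fun h => hvy h.2))

/-! ### DAGs from numberings of the vertices -/

/-- The edges of `K`, directed along the numbering `f`. -/
def ofRank (K : SimpleGraph V) (f : V → ℕ) : PDGraph V where
  dir a b := K.Adj a b ∧ f a < f b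
  undir _ _ := False
  dir_asymm _ _ h h' := lt_asymm h.2 h'.2
  undir_symm _ _ h := h
  undir_irrefl _ h := h
  not_undir_of_dir _ _ _ h := h

theorem isDAG_ofRank (K : SimpleGraph V) (f : V → ℕ) : (ofRank K f).IsDAG :=
  ⟨IsPDAG.of_rank (f := f) fun _ _ h => h.2, fun _ _ h => h⟩

/-- The numbering `f` separates the ends of each edge of `K`. -/
def IsProper (K : SimpleGraph V) (f : V → ℕ) : Prop := ∀ a b, K.Adj a b → f a ≠ f b

theorem skeleton_ofRank {K : SimpleGraph V} {f : V → ℕ} (hf : IsProper K f) :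
    (ofRank K f).skeleton = K := by
  ext a b
  constructor
  · rintro (h | h | h)
    · exact h.1
    · exact h.1.symm
    · exact h.elim
  · intro h
    rcases lt_or_gt_of_ne (hf a b h) with h' | h'
    · exact Or.inl ⟨h, h'⟩
    · exact Or.inr (Or.inl ⟨h.symm, h'⟩)

theorem isProper_of_dir_lt (hG : G.IsDAG) {f : V → ℕ} (hf : ∀ a b, G.dir a b → f a < f b) :
    IsProper G.skeleton f := by
  intro a b h
  rcases hG.dir_or_dir h with h | h
  · exact (hf _ _ h).ne
  · exact (hf _ _ h).ne'

theorem dir_iff_of_rank (hG : G.IsDAG) {f : V → ℕ} (hf : ∀ a b, G.dir a b → f a < f b) (a b : V) :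
    G.dir a b ↔ G.skeleton.Adj a b ∧ f a < f b := by
  refine ⟨fun h => ⟨adj_of_dir h, hf _ _ h⟩, fun h => (hG.dir_or_dir h.1).resolve_right ?_⟩
  exact fun h' => lt_asymm h.2 (hf _ _ h')

theorem IsDAG.ext (hG : G.IsDAG) (hG' : G'.IsDAG) (h : ∀ a b, G.dir a b ↔ G'.dir a b) :
    G = G' := by
  apply PDGraph.ext
  · funext a b
    exact propext (h a b)
  · funext a b
    exact propext ⟨fun h => absurd h (hG.2 a b), fun h => absurd h (hG'.2 a b)⟩

theorem eq_ofRank (hG : G.IsDAG) {f : V → ℕ} (hf : ∀ a b, G.dir a b → f a < f b) :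
    G = ofRank G.skeleton f :=
  hG.ext (isDAG_ofRank _ _) (dir_iff_of_rank hG hf)

/-! ### Covered edges -/

/-- The edge `x → y` is covered: the parents of `y` are `x` and the parents of `x`. -/
structure IsCovered (K : SimpleGraph V) (f : V → ℕ) (x y : V) : Prop where
  adj : K.Adj x y
  lt : f x < f y
  of_head : ∀ z, z ≠ x → K.Adj z y → f z < f y → K.Adj z x ∧ f z < f x
  of_tail : ∀ z, K.Adj z x → f z < f x → K.Adj z y

open Classical in
/-- Moves `y` to the place right before `x`. -/
noncomputable def flipRank (f : V → ℕ) (x y : V) : V → ℕ :=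
  fun v => if v = y then 2 * f x else 2 * f v + 1

/-- By `of_head` all neighbours of `y` below `y`, apart from `x`, lie below `x`. Moving `y` down
therefore crosses no neighbour but `x`. -/
theorem IsCovered.flipRank_lt_iff {K : SimpleGraph V} {f : V → ℕ} {x y : V}
    (h : IsCovered K f x y) (hf : IsProper K f) {a b : V} (hab : K.Adj a b) :
    flipRank f x y a < flipRank f x y b ↔
      (f a < f b ∧ ¬ (a = x ∧ b = y)) ∨ (a = y ∧ b = x) := by
  have hlt := h.lt
  have hne := h.adj.ne
  unfold flipRank
  by_cases ha : a = y
  · subst ha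
    have hb : b ≠ a := hab.ne.symm
    simp only [if_true, if_neg hb]
    by_cases hbx : b = x
    · simp [hbx]
    · have h1 := hf _ _ hab
      have h2 := h.of_head b hbx hab.symm
      simp only [hb, hbx, and_false, not_false_eq_true, and_true, or_false]
      constructor
      · intro h3
        by_contra h4
        have := (h2 (by omega)).2
        omega
      · intro h3
        omega
  · by_cases hb : b = y
    · subst hb
      simp only [if_true, if_false, ha, false_and, and_true, or_false]
      constructor
      · intro h3
        refine ⟨by omega, ?_⟩
        rintro rfl
        omega
      · rintro ⟨h3, h4⟩
        have := (h.of_head a h4 hab h3).2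
        omega
    · simp only [if_false, ha, hb, and_false, false_and, not_false_eq_true, and_true,
        or_false]
      omega

theorem IsCovered.isProper_flipRank {K : SimpleGraph V} {f : V → ℕ} {x y : V}
    (h : IsCovered K f x y) (hf : IsProper K f) : IsProper K (flipRank f x y) := by
  intro a b hab
  rcases lt_or_gt_of_ne (hf a b hab) with h' | h'
  · by_cases hc : a = x ∧ b = y
    · exact ((h.flipRank_lt_iff hf hab.symm).2 (Or.inr ⟨hc.2, hc.1⟩)).ne'
    · exact ((h.flipRank_lt_iff hf hab).2 (Or.inl ⟨h', hc⟩)).ne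
  · by_cases hc : b = x ∧ a = y
    · exact ((h.flipRank_lt_iff hf hab).2 (Or.inr ⟨hc.2, hc.1⟩)).ne
    · exact ((h.flipRank_lt_iff hf hab.symm).2 (Or.inl ⟨h', hc⟩)).ne'

/-- Two numberings yield the same v-structures. -/
def SameColliders (K : SimpleGraph V) (f g : V → ℕ) : Prop :=
  ∀ a b c, K.Adj a b → K.Adj c b → a ≠ c → ¬ K.Adj a c →
    ((f a < f b ∧ f c < f b) ↔ (g a < g b ∧ g c < g b))

theorem IsCovered.sameColliders_flipRank {K : SimpleGraph V} {f : V → ℕ} {x y : V}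
    (h : IsCovered K f x y) (hf : IsProper K f) : SameColliders K f (flipRank f x y) := by
  intro a b c hab hcb hac hn
  rw [h.flipRank_lt_iff hf hab, h.flipRank_lt_iff hf hcb]
  constructor
  · rintro ⟨h1, h2⟩
    refine ⟨Or.inl ⟨h1, ?_⟩, Or.inl ⟨h2, ?_⟩⟩
    · rintro ⟨rfl, rfl⟩
      exact hn (h.of_head c hac.symm hcb h2).1.symm
    · rintro ⟨rfl, rfl⟩
      exact hn (h.of_head a hac hab h1).1
  · rintro ⟨h1 | ⟨ha, hb⟩, h2 | ⟨hc, hb'⟩⟩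
    · exact ⟨h1.1, h2.1⟩
    · subst hc hb'
      exact absurd (h.of_tail a hab h1.1) hn
    · subst ha hb
      exact absurd (h.of_tail c hcb h2.1).symm hn
    · exact absurd (ha.trans hc.symm) hac

/-- Among the edges on which `f` and `g` disagree, take the lowest head `y` in `f` and then the
highest tail `x`. Edges into vertices before `y`, and edges into `y` from vertices between `x` and
`y`, agree in `f` and `g`. A failure of coveredness would then give a collider in only one of the
two orders, or a cycle in `g`. -/
theorem exists_isCovered [Finite V] {K : SimpleGraph V} {f g : V → ℕ} (hf : IsProper K f)
    (hg : IsProper K g) (hfg : SameColliders K f g)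
    (h : ∃ x y, K.Adj x y ∧ f x < f y ∧ g y < g x) :
    ∃ x y, IsCovered K f x y ∧ g y < g x := by
  obtain ⟨y, ⟨x₀, hx₀⟩, hmin⟩ := Set.exists_min_image
    {y | ∃ x, K.Adj x y ∧ f x < f y ∧ g y < g x} f (Set.toFinite _)
    (let ⟨x, y, h⟩ := h; ⟨y, x, h⟩)
  obtain ⟨x, ⟨hxy, hfx, hgx⟩, hmax⟩ := Set.exists_max_image
    {x | K.Adj x y ∧ f x < f y ∧ g y < g x} f (Set.toFinite _) ⟨x₀, hx₀⟩
  have hearly : ∀ z w, K.Adj z w → f w < f y → f z < f w → g z < g w := by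
    intro z w hzw hw hz
    by_contra hlt
    have : f y ≤ f w := hmin w ⟨z, hzw, hz, lt_of_le_of_ne (not_lt.1 hlt) (hg _ _ hzw).symm⟩
    omega
  have hlate : ∀ z, K.Adj z y → f x < f z → f z < f y → g z < g y := by
    intro z hz h1 h2
    by_contra hlt
    have : f z ≤ f x := hmax z ⟨hz, h2, lt_of_le_of_ne (not_lt.1 hlt) (hg _ _ hz).symm⟩
    omega
  refine ⟨x, y, ⟨hxy, hfx, fun z hzx hzy hlt => ?_, fun z hzx hlt => ?_⟩, hgx⟩
  · have hadj : K.Adj z x := by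
      by_contra hn
      have := (hfg z y x hzy hxy hzx hn).1 ⟨hlt, hfx⟩
      omega
    refine ⟨hadj, ?_⟩
    by_contra hn
    have hxz : f x < f z := lt_of_le_of_ne (not_lt.1 hn) (hf _ _ hadj).symm
    have h1 := hlate z hzy hxz hlt
    have h2 := hearly x z hadj.symm hlt hxz
    omega
  · by_contra hn
    have hzy : z ≠ y := by
      rintro rfl
      omega
    have h1 := hearly z x hzx hfx hlt
    have := (hfg z x y hzx hxy.symm hzy hn).2 ⟨h1, hgx⟩
    omega

/-- Induction on the number of edges on which `f` and `g` disagree: reversing a covered edge of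
disagreement removes one and creates none. -/
theorem ActiveWalk.of_sameColliders [Finite V] {K : SimpleGraph V} {g : V → ℕ}
    (hg : IsProper K g) {S : Set V} {a v : V} (n : ℕ) :
    ∀ f : V → ℕ, IsProper K f → SameColliders K f g →
      {e : V × V | K.Adj e.1 e.2 ∧ f e.1 < f e.2 ∧ g e.2 < g e.1}.ncard = n →
      ∀ m, (ofRank K f).ActiveWalk S a m v → ∃ m', (ofRank K g).ActiveWalk S a m' v := by
  induction n using Nat.strong_induction_on with
  | _ n ih =>
  intro f hf hfg hn m hm
  by_cases hex : ∃ x y, K.Adj x y ∧ f x < f y ∧ g y < g x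
  · obtain ⟨x, y, hcov, hgxy⟩ := exists_isCovered hf hg hfg hex
    have hyx : (ofRank K (flipRank f x y)).dir y x :=
      ⟨hcov.adj.symm, (hcov.flipRank_lt_iff hf hcov.adj.symm).2 (Or.inr ⟨rfl, rfl⟩)⟩
    have hxy : (ofRank K f).dir x y := ⟨hcov.adj, hcov.lt⟩
    have hinv : (ofRank K (flipRank f x y)).FlipInvariant S a x y m v := by
      refine hm.flipInvariant hxy (fun z hzx => ⟨fun h => ?_, fun h => ?_⟩)
        hyx ?_
      · exact hcov.of_head z hzx h.1 h.2
      · exact ⟨hcov.of_tail z h.1 h.2, h.2.trans hcov.lt⟩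
      · exact fun u w h hne => ⟨h.1, (hcov.flipRank_lt_iff hf h.1).2 (Or.inl ⟨h.2, hne⟩)⟩
    obtain ⟨m', hm'⟩ := hinv.exists_activeWalk hyx
    refine ih _ ?_ (flipRank f x y) (hcov.isProper_flipRank hf) ?_ rfl m' hm'
    · rw [← hn]
      refine Set.ncard_lt_ncard ⟨?_, fun hsub => ?_⟩ (Set.toFinite _)
      · rintro ⟨u, w⟩ ⟨h1, h2, h3⟩
        rcases (hcov.flipRank_lt_iff hf h1).1 h2 with h | ⟨h, h'⟩
        · exact ⟨h1, h.1, h3⟩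
        · simp only at h h' h3
          subst h h'
          omega
      · obtain ⟨-, h2, -⟩ := hsub (a := (x, y)) ⟨hcov.adj, hcov.lt, hgxy⟩
        rcases (hcov.flipRank_lt_iff hf hcov.adj).1 h2 with h | h
        · exact h.2 ⟨rfl, rfl⟩
        · exact hcov.adj.ne h.1
    · intro p q r h1 h2 h3 h4
      rw [← hfg p q r h1 h2 h3 h4, hcov.sameColliders_flipRank hf p q r h1 h2 h3 h4]
  · have : ofRank K f = ofRank K g := by
      refine (isDAG_ofRank K f).ext (isDAG_ofRank K g) fun u w => and_congr_right fun huw => ?_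
      have h1 := hf _ _ huw
      have h2 := hg _ _ huw
      have h3 := fun h h' => hex ⟨u, w, huw, h, h'⟩
      have h4 := fun h h' => hex ⟨w, u, huw.symm, h, h'⟩
      constructor <;> intro h <;> by_contra h'
      · exact h3 h (by omega)
      · exact h4 (by omega) h
    exact ⟨m, this ▸ hm⟩

/-- DAGs with the same skeleton and the same v-structures are Markov equivalent. -/
theorem SameSkeletonAndVStructures.markovEquivalent [Finite V]
    (h : G.SameSkeletonAndVStructures G') (hG : G.IsDAG) (hG' : G'.IsDAG) :
    G.MarkovEquivalent G' := by
  obtain ⟨f, hf⟩ := hG.1.exists_rank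
  obtain ⟨g, hg⟩ := hG'.1.exists_rank
  have hpf := isProper_of_dir_lt hG hf
  have hpg := isProper_of_dir_lt hG' hg
  have hef := eq_ofRank hG hf
  have heg := eq_ofRank hG' hg
  obtain ⟨hs, hv⟩ := h
  rw [← hs] at hpg heg
  have hfg : SameColliders G.skeleton f g := by
    intro a b c hab hcb hac hn
    have := hv a b c
    simp only [IsVStructure, dir_iff_of_rank hG hf, dir_iff_of_rank hG' hg, ← hs] at this
    tauto
  have hgf : SameColliders G.skeleton g f :=
    fun a b c h1 h2 h3 h4 => (hfg a b c h1 h2 h3 h4).symm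
  intro X Y S _ hXS hYS
  rw [dSeparated_iff_singleton, dSeparated_iff_singleton (G := G')]
  refine forall₂_congr fun x hx => forall₂_congr fun y hy => ?_
  have hxS := Set.disjoint_left.1 hXS hx
  have hyS := Set.disjoint_left.1 hYS hy
  rw [← not_iff_not, not_dSeparated_singleton_iff hG hxS hyS,
    not_dSeparated_singleton_iff hG' hxS hyS, hef, heg]
  constructor
  · rintro ⟨m, hm⟩
    exact ActiveWalk.of_sameColliders hpg _ f hpf hfg rfl m hm
  · rintro ⟨m, hm⟩
    exact ActiveWalk.of_sameColliders hpf _ g hpg hgf rfl m hm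

/-! ### Consistent extensions of a partially directed graph -/

/-- On the vertex set `S`, the numbering `f` extends the directed edges of `H` and creates no
v-structure that `H` does not have. -/
structure IsExt (H : PDGraph V) (S : Set V) (f : V → ℕ) : Prop where
  proper : ∀ a ∈ S, ∀ b ∈ S, H.skeleton.Adj a b → f a ≠ f b
  dir_lt : ∀ a ∈ S, ∀ b ∈ S, H.dir a b → f a < f b
  dir_of_collider : ∀ a ∈ S, ∀ b ∈ S, ∀ c ∈ S, H.skeleton.Adj a b → H.skeleton.Adj c b → a ≠ c →
    ¬ H.skeleton.Adj a c → f a < f b → f c < f b → H.dir a b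

theorem IsExt.mono {S T : Set V} {f : V → ℕ} (h : H.IsExt T f) (hST : S ⊆ T) : H.IsExt S f :=
  ⟨fun a ha b hb => h.proper a (hST ha) b (hST hb),
    fun a ha b hb => h.dir_lt a (hST ha) b (hST hb),
    fun a ha b hb c hc => h.dir_of_collider a (hST ha) b (hST hb) c (hST hc)⟩

/-- `H` has a consistent extension, and each undirected edge occurs with either direction in some
consistent extension. -/
structure IsMaximallyOriented (H : PDGraph V) : Prop where
  exists_isExt : ∃ f, H.IsExt Set.univ f
  exists_of_undir : ∀ a b, H.undir a b → ∃ f, H.IsExt Set.univ f ∧ f a < f b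

/-- Meek's first rule: an extension with `c → b` would have a new collider at `b`. -/
theorem IsMaximallyOriented.adj_of_dir_of_undir (hH : H.IsMaximallyOriented) {a b c : V}
    (hab : H.dir a b) (hbc : H.undir b c) (hac : a ≠ c) : H.skeleton.Adj a c := by
  by_contra hn
  obtain ⟨f, hf, hlt⟩ := hH.exists_of_undir c b (H.undir_symm _ _ hbc)
  have := hf.dir_of_collider c trivial b trivial a trivial (adj_of_undir hbc).symm (adj_of_dir hab)
    hac.symm (fun h => hn h.symm) hlt (hf.dir_lt a trivial b trivial hab)
  exact H.not_undir_of_dir _ _ this (H.undir_symm _ _ hbc)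

/-- Meek's second rule: an extension with `c → a` would have a directed cycle. -/
theorem IsMaximallyOriented.not_undir (hH : H.IsMaximallyOriented) {a b c : V}
    (hab : H.dir a b) (hbc : H.dir b c) : ¬ H.undir a c := by
  intro h
  obtain ⟨f, hf, hlt⟩ := hH.exists_of_undir c a (H.undir_symm _ _ h)
  have h1 := hf.dir_lt a trivial b trivial hab
  have h2 := hf.dir_lt b trivial c trivial hbc
  omega

/-- The local conditions for `s` to be the last vertex of a consistent extension on `S`. -/
structure IsTerminal (H : PDGraph V) (S : Set V) (s : V) : Prop where
  mem : s ∈ S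
  not_dir : ∀ u ∈ S, ¬ H.dir s u
  adj : ∀ u ∈ S, ∀ v ∈ S, H.undir s u → H.skeleton.Adj v s → v ≠ u → H.skeleton.Adj u v

theorem IsExt.isTerminal {S : Set V} {f : V → ℕ} (hf : H.IsExt S f) {s : V} (hs : s ∈ S)
    (hmax : ∀ u ∈ S, f u ≤ f s) : H.IsTerminal S s := by
  refine ⟨hs, fun u hu h => ?_, fun u hu v hv hsu hvs hne => ?_⟩
  · exact absurd (hf.dir_lt s hs u hu h) (not_lt.2 (hmax u hu))
  · by_contra hn
    have hus := (adj_of_undir hsu).symm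
    have := hf.dir_of_collider u hu s hs v hv hus hvs hne.symm hn
      (lt_of_le_of_ne (hmax u hu) (hf.proper u hu s hs hus))
      (lt_of_le_of_ne (hmax v hv) (hf.proper v hv s hs hvs))
    exact H.not_undir_of_dir _ _ this (H.undir_symm _ _ hsu)

theorem IsExt.exists_isTerminal [Finite V] {S : Set V} {f : V → ℕ} (hf : H.IsExt S f)
    (hS : S.Nonempty) : ∃ s, H.IsTerminal S s ∧ ∀ u ∈ S, f u ≤ f s := by
  obtain ⟨s, hs, hmax⟩ := Set.exists_max_image S f (Set.toFinite S) hS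
  exact ⟨s, hf.isTerminal hs hmax, hmax⟩

theorem IsTerminal.dir_or_undir {S : Set V} {s p : V} (hs : H.IsTerminal S s) (hp : p ∈ S)
    (h : H.skeleton.Adj p s) : H.dir p s ∨ H.undir s p := by
  rcases h with h | h | h
  · exact Or.inl h
  · exact absurd h (hs.not_dir p hp)
  · exact Or.inr (H.undir_symm _ _ h)

theorem IsTerminal.dir_of_not_adj {S : Set V} {s a c : V} (hs : H.IsTerminal S s) (ha : a ∈ S)
    (hc : c ∈ S) (has : H.skeleton.Adj a s) (hcs : H.skeleton.Adj c s) (hac : a ≠ c)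
    (hn : ¬ H.skeleton.Adj a c) : H.dir a s :=
  (hs.dir_or_undir ha has).resolve_right fun h => hn (hs.adj a ha c hc h hcs hac.symm)

/-- A terminal vertex can be inserted into a consistent extension on the other vertices at any place
where it creates no v-structure in its children. -/
theorem IsTerminal.isExt {S : Set V} {s : V} (hs : H.IsTerminal S s) {f g : V → ℕ}
    (hf : H.IsExt (S \ {s}) f) (hlt : ∀ p q, p ≠ s → q ≠ s → (g p < g q ↔ f p < f q))
    (hne : ∀ p ∈ S, p ≠ s → g p ≠ g s) (hdir : ∀ p ∈ S, H.dir p s → g p < g s)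
    (hcol : ∀ z ∈ S, ∀ c ∈ S, z ≠ s → c ≠ s → H.skeleton.Adj s z → H.skeleton.Adj c z →
      ¬ H.skeleton.Adj c s → g s < g z → g c < g z → False) : H.IsExt S g := by
  refine ⟨fun a ha b hb hab => ?_, fun a ha b hb hab => ?_,
    fun a ha b hb c hc hab hcb hac hn hga hgc => ?_⟩
  · by_cases has : a = s
    · subst has
      exact (hne b hb hab.ne.symm).symm
    by_cases hbs : b = s
    · subst hbs
      exact hne a ha has
    have h1 := hlt a b has hbs
    have h2 := hlt b a hbs has
    have h3 := hf.proper a ⟨ha, has⟩ b ⟨hb, hbs⟩ hab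
    omega
  · by_cases has : a = s
    · subst has
      exact absurd hab (hs.not_dir b hb)
    by_cases hbs : b = s
    · subst hbs
      exact hdir a ha hab
    exact (hlt a b has hbs).2 (hf.dir_lt a ⟨ha, has⟩ b ⟨hb, hbs⟩ hab)
  · by_cases hbs : b = s
    · subst hbs
      exact hs.dir_of_not_adj ha hc hab hcb hac hn
    by_cases has : a = s
    · subst has
      exact (hcol b hb c hc hbs hac.symm hab hcb (fun h => hn h.symm) hga hgc).elim
    by_cases hcs : c = s
    · subst hcs
      exact (hcol b hb a ha hbs hac hcb hab hn hgc hga).elim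
    exact hf.dir_of_collider a ⟨ha, has⟩ b ⟨hb, hbs⟩ c ⟨hc, hcs⟩ hab hcb hac hn
      ((hlt a b has hbs).1 hga) ((hlt c b hcs hbs).1 hgc)

/-- At the top `s` has no children, so no collider can arise there. With `IsExt.isTerminal` this
makes terminality the exact condition for coming last, given an extension on the rest. -/
theorem IsTerminal.exists_isExt_top [Finite V] {S : Set V} {s : V} (hs : H.IsTerminal S s)
    {f : V → ℕ} (hf : H.IsExt (S \ {s}) f) :
    ∃ g, H.IsExt S g ∧ (∀ v, v ≠ s → g v = f v) ∧ ∀ v, v ≠ s → g v < g s := by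
  classical
  obtain ⟨M, hM⟩ := (Set.finite_range f).bddAbove
  have hM' : ∀ v, f v < M + 1 := fun v => Nat.lt_succ_of_le (hM ⟨v, rfl⟩)
  have hg : ∀ v, v ≠ s → Function.update f s (M + 1) v = f v :=
    fun v hv => Function.update_of_ne hv _ _
  have hgs : ∀ v, v ≠ s → Function.update f s (M + 1) v < Function.update f s (M + 1) s := by
    intro v hv
    rw [hg v hv, Function.update_self]
    exact hM' v
  refine ⟨Function.update f s (M + 1), hs.isExt hf ?_ ?_ ?_ ?_, hg, hgs⟩
  · intro p q hp hq
    rw [hg p hp, hg q hq]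
  · exact fun p _ hp => (hgs p hp).ne
  · exact fun p _ hp => hgs p (ne_of_dir hp)
  · exact fun z _ c _ hz _ _ _ _ h _ => lt_asymm h (hgs z hz)

/-- A set `W` of undirected neighbours of `x` is the set of those that are parents of `x` in some
consistent extension, provided that it is a clique and has no parents among the others. -/
theorem IsMaximallyOriented.exists_isExt_of_clique [Finite V] (hH : H.IsMaximallyOriented) (n : ℕ) :
    ∀ (S : Set V), S.ncard = n → ∀ (x : V) (W : Set V), x ∈ S → W ⊆ S →
      (∀ w ∈ W, H.undir x w) → (∀ v ∈ W, ∀ w ∈ W, v ≠ w → H.skeleton.Adj v w) →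
      (∀ u ∈ S, H.undir x u → u ∉ W → ∀ w ∈ W, ¬ H.dir u w) →
      ∃ f, H.IsExt S f ∧ ∀ u ∈ S, H.undir x u → (f u < f x ↔ u ∈ W) := by
  classical
  induction n using Nat.strong_induction_on with
  | _ n ih =>
  intro S hn x W hx hWS hW hcl hnd
  have hcard : ∀ s ∈ S, (S \ {s}).ncard < n := fun s hs =>
    hn ▸ Set.ncard_sdiff_singleton_lt_of_mem hs (Set.toFinite S)
  -- A terminal vertex outside `W ∪ {x}` is put back on top, where it is no parent of `x`.
  by_cases h0 : ∃ s, H.IsTerminal S s ∧ s ≠ x ∧ s ∉ W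
  · obtain ⟨s, hs, hsx, hsW⟩ := h0
    obtain ⟨f, hf, hfx⟩ := ih _ (hcard s hs.mem) (S \ {s}) rfl x W ⟨hx, hsx.symm⟩
      (fun w hw => ⟨hWS hw, fun h => hsW (h ▸ hw)⟩) hW hcl (fun u hu => hnd u hu.1)
    obtain ⟨g, hg, hgf, hgs⟩ := hs.exists_isExt_top hf
    refine ⟨g, hg, fun u hu hxu => ?_⟩
    by_cases hus : u = s
    · subst hus
      exact iff_of_false (not_lt.2 (hgs x hsx.symm).le) hsW
    · rw [hgf u hus, hgf x hsx.symm]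
      exact hfx u ⟨hu, hus⟩ hxu
  push Not at h0
  by_cases hun : ∃ u ∈ S, H.undir x u
  swap
  · obtain ⟨f, hf⟩ := hH.exists_isExt
    exact ⟨f, hf.mono (Set.subset_univ S), fun u hu h => absurd ⟨u, hu, h⟩ hun⟩
  obtain ⟨u, hu, hxu⟩ := hun
  -- Now every terminal vertex is `x` or lies in `W`. An extension with `x` before `u` ends on `S`
  -- in some `w ∈ W`; one with `w` before `x` ends in a second terminal vertex `t`.
  obtain ⟨f₁, hf₁, hlt₁⟩ := hH.exists_of_undir x u hxu
  obtain ⟨w, hw, hmax₁⟩ := (hf₁.mono (Set.subset_univ S)).exists_isTerminal ⟨x, hx⟩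
  have hwx : w ≠ x := by
    rintro rfl
    exact absurd (hmax₁ u hu) (not_le.2 hlt₁)
  have hwW : w ∈ W := h0 w hw hwx
  have hxw := hW w hwW
  have hwx' := H.undir_symm _ _ hxw
  obtain ⟨f₂, hf₂, hlt₂⟩ := hH.exists_of_undir w x hwx'
  obtain ⟨t, ht, hmax₂⟩ := (hf₂.mono (Set.subset_univ S)).exists_isTerminal ⟨x, hx⟩
  have htw : t ≠ w := by
    rintro rfl
    exact absurd (hmax₂ x hx) (not_le.2 hlt₂)
  by_cases htx : t = x
  · -- `w` and `x` are terminal twins: put `x` right after `w`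
    subst htx
    have hwt : ∀ z ∈ S, z ≠ t → z ≠ w → (H.skeleton.Adj z w ↔ H.skeleton.Adj z t) := fun z hz h1 h2 =>
      ⟨fun h => (hw.adj t hx z hz hwx' h h1).symm, fun h => (ht.adj w hw.mem z hz hxw h h2).symm⟩
    -- Right after `w`, the vertex `t` gets `w` and those of its neighbours that precede `w`. So the
    -- rest of `W` and the directed parents of `t` have to precede `w`.
    obtain ⟨f, hf, hfw⟩ := ih _ (hcard t hx) (S \ {t}) rfl w
      {v | v ∈ S \ {t} ∧ H.undir w v ∧ (v ∈ W ∨ H.dir v t)} ⟨hw.mem, hwx⟩ (fun v hv => hv.1)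
      (fun v hv => hv.2.1)
      (fun v hv v' hv' hne => hw.adj v hv.1.1 v' hv'.1.1 hv.2.1 (adj_of_undir hv'.2.1).symm hne.symm)
      (by
        rintro z ⟨hz, hzt⟩ hwz hzW v ⟨⟨hv, -⟩, -, hvW⟩ hzv
        have hzw : z ≠ w := (adj_of_undir hwz).ne.symm
        rcases ht.dir_or_undir hz ((hwt z hz hzt hzw).1 (adj_of_undir hwz).symm) with h | h
        · exact hzW ⟨⟨hz, hzt⟩, hwz, Or.inr h⟩
        · rcases hvW with hvW | hvt
          · exact hnd z hz h (fun h' => hzW ⟨⟨hz, hzt⟩, hwz, Or.inl h'⟩) v hvW hzv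
          · exact hH.not_undir hzv hvt (H.undir_symm _ _ h))
    -- Doubling frees an odd value directly above `w`.
    have hg : ∀ v, v ≠ t → Function.update (fun v => 2 * f v) t (2 * f w + 1) v = 2 * f v :=
      fun v hv => Function.update_of_ne hv _ _
    have hgt : Function.update (fun v => 2 * f v) t (2 * f w + 1) t = 2 * f w + 1 :=
      Function.update_self _ _ _
    refine ⟨Function.update (fun v => 2 * f v) t (2 * f w + 1), ht.isExt hf ?_ ?_ ?_ ?_, ?_⟩
    · intro p q hp hq
      rw [hg p hp, hg q hq]
      omega
    · intro p _ hp
      rw [hg p hp, hgt]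
      omega
    · intro p hp hpt
      have hpt' := ne_of_dir hpt
      have hpw : p ≠ w := by
        rintro rfl
        exact H.not_undir_of_dir _ _ hpt hwx'
      rw [hg p hpt', hgt]
      suffices f p < f w by omega
      rcases hw.dir_or_undir hp ((hwt p hp hpt' hpw).2 (adj_of_dir hpt)) with h | h
      · exact hf.dir_lt p ⟨hp, hpt'⟩ w ⟨hw.mem, hwx⟩ h
      · exact (hfw p ⟨hp, hpt'⟩ h).2 ⟨⟨hp, hpt'⟩, h, Or.inr hpt⟩
    · intro z hz c hc hzt hct htz hcz hctn hgz hgc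
      rw [hg z hzt, hgt] at hgz
      rw [hg z hzt, hg c hct] at hgc
      have hwz : f w < f z := by omega
      have hzw : z ≠ w := by
        rintro rfl
        omega
      have hcw : c ≠ w := by
        rintro rfl
        exact hctn (adj_of_undir hwx')
      -- A new collider `t → z ← c` would already occur as `w → z ← c`, with the twin `w` for `t`;
      -- then `w → z` is directed in `H`, against terminality.
      exact hw.not_dir z hz (hf.dir_of_collider w ⟨hw.mem, hwx⟩ z ⟨hz, hzt⟩ c ⟨hc, hct⟩
        ((hwt z hz hzt hzw).2 htz.symm).symm hcz hcw.symm
        (fun h => hctn ((hwt c hc hct hcw).1 h.symm)) hwz (by omega))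
    · intro v hv htv
      have hvt : v ≠ t := (adj_of_undir htv).ne.symm
      rw [hg v hvt, hgt]
      by_cases hvw : v = w
      · subst hvw
        exact iff_of_true (by omega) hwW
      have hadj := (hwt v hv hvt hvw).2 (adj_of_undir htv).symm
      have hne := hf.proper v ⟨hv, hvt⟩ w ⟨hw.mem, hwx⟩ hadj
      rcases hw.dir_or_undir hv hadj with h | h
      · refine iff_of_true ?_ ?_
        · have := hf.dir_lt v ⟨hv, hvt⟩ w ⟨hw.mem, hwx⟩ h
          omega
        · by_contra hvW
          exact hnd v hv htv hvW w hwW h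
      · have h1 := hfw v ⟨hv, hvt⟩ h
        have h2 : ¬ H.dir v t := fun h' => H.not_undir_of_dir _ _ h' (H.undir_symm _ _ htv)
        constructor
        · intro h3
          exact (h1.1 (by omega)).2.2.resolve_right h2
        · intro h3
          have := h1.2 ⟨⟨hv, hvt⟩, h, Or.inl h3⟩
          omega
  · -- `w` and `t` are terminal twins in `W`: put `t` right before `x`
    have htW : t ∈ W := h0 t ht htx
    have hxt := hW t htW
    have htx' := H.undir_symm _ _ hxt
    have htw' : H.undir t w := by
      rcases ht.dir_or_undir hw.mem (hcl w hwW t htW htw.symm) with h | h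
      · exact absurd h (hw.not_dir t ht.mem)
      · exact h
    obtain ⟨f, hf, hfx⟩ := ih _ (hcard t ht.mem) (S \ {t}) rfl x (W \ {t}) ⟨hx, fun h => htx h.symm⟩
      (fun v hv => ⟨hWS hv.1, hv.2⟩) (fun v hv => hW v hv.1)
      (fun v hv v' hv' => hcl v hv.1 v' hv'.1)
      (fun z hz hxz hzW v hv => hnd z hz.1 hxz (fun h => hzW ⟨h, hz.2⟩) v hv.1)
    -- Odd values for the others leave `2 * f x` free directly below `x`.
    have hg : ∀ v, v ≠ t → Function.update (fun v => 2 * f v + 1) t (2 * f x) v = 2 * f v + 1 :=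
      fun v hv => Function.update_of_ne hv _ _
    have hgt : Function.update (fun v => 2 * f v + 1) t (2 * f x) t = 2 * f x :=
      Function.update_self _ _ _
    have hxt' : x ≠ t := fun h => htx h.symm
    refine ⟨Function.update (fun v => 2 * f v + 1) t (2 * f x), ht.isExt hf ?_ ?_ ?_ ?_, ?_⟩
    · intro p q hp hq
      rw [hg p hp, hg q hq]
      omega
    · intro p _ hp
      rw [hg p hp, hgt]
      omega
    · intro p hp hpt
      have hpt' := ne_of_dir hpt
      have hpx : p ≠ x := by
        rintro rfl
        exact H.not_undir_of_dir _ _ hpt hxt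
      rw [hg p hpt', hgt]
      suffices f p < f x by omega
      rcases ht.adj x hx p hp htx' (adj_of_dir hpt) hpx with h | h | h
      · exact absurd hxt (hH.not_undir h hpt)
      · exact hf.dir_lt p ⟨hp, hpt'⟩ x ⟨hx, hxt'⟩ h
      · refine (hfx p ⟨hp, hpt'⟩ h).2 ⟨?_, hpt'⟩
        by_contra hpW
        exact hnd p hp h hpW t htW hpt
    · intro z hz c hc hzt hct htz hcz hctn hgz hgc
      rw [hg z hzt, hgt] at hgz
      rw [hg z hzt, hg c hct] at hgc
      have hcz' : f c < f z := by omega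
      -- At `x` the new parent `t` is adjacent to all others, by Meek's first rule or because `W` is
      -- a clique. At any other child, `w` stands in for `t`, as before.
      by_cases hzx : z = x
      · subst hzx
        rcases hcz with h | h | h
        · exact hctn (hH.adj_of_dir_of_undir h hxt hct)
        · have := hf.dir_lt z ⟨hx, hxt'⟩ c ⟨hc, hct⟩ h
          omega
        · have h' := H.undir_symm _ _ h
          exact hctn (hcl c ((hfx c ⟨hc, hct⟩ h').1 hcz').1 t htW hct)
      have hadj : H.skeleton.Adj x z := ht.adj x hx z hz htx' htz.symm hzx
      have hne := hf.proper x ⟨hx, hxt'⟩ z ⟨hz, hzt⟩ hadj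
      have hwxlt : f w < f x := (hfx w ⟨hw.mem, htw.symm⟩ hxw).2 ⟨hwW, htw.symm⟩
      have hzw : z ≠ w := by
        rintro rfl
        omega
      have hcw : c ≠ w := by
        rintro rfl
        exact hctn (adj_of_undir htw').symm
      exact hw.not_dir z hz (hf.dir_of_collider w ⟨hw.mem, htw.symm⟩ z ⟨hz, hzt⟩ c ⟨hc, hct⟩
        (ht.adj w hw.mem z hz htw' htz.symm hzw) hcz hcw.symm
        (fun h => hctn (hw.adj t ht.mem c hc (H.undir_symm _ _ htw') h.symm hct).symm)
        (by omega) hcz')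
    · intro v hv hxv
      have hvx : v ≠ x := (adj_of_undir hxv).ne.symm
      rw [hg x hxt']
      by_cases hvt : v = t
      · subst hvt
        rw [hgt]
        exact iff_of_true (by omega) htW
      · rw [hg v hvt]
        have := hfx v ⟨hv, hvt⟩ hxv
        simp only [Set.mem_sdiff, Set.mem_singleton_iff, hvt, not_false_eq_true, and_true] at this
        rw [← this]
        omega

/-- An unprotected directed edge is covered in some consistent extension. -/
theorem IsMaximallyOriented.exists_isExt_isCovered [Finite V] (hH : H.IsMaximallyOriented)
    {x y : V} (hxy : H.dir x y) (hunp : ¬ H.MStronglyProtected x y) (n : ℕ) :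
    ∀ (S : Set V), S.ncard = n → x ∈ S → y ∈ S → ∃ f, H.IsExt S f ∧
      (∀ z ∈ S, z ≠ x → H.skeleton.Adj z y → f z < f y → H.skeleton.Adj z x ∧ f z < f x) ∧
      (∀ z ∈ S, H.skeleton.Adj z x → f z < f x → H.skeleton.Adj z y) := by
  induction n using Nat.strong_induction_on with
  | _ n ih =>
  intro S hn hx hy
  by_cases h0 : ∃ s, H.IsTerminal S s ∧ s ≠ y
  · obtain ⟨s, hs, hsy⟩ := h0
    have hsx : s ≠ x := by
      rintro rfl
      exact hs.not_dir y hy hxy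
    obtain ⟨f, hf, h1, h2⟩ := ih _ (hn ▸ Set.ncard_sdiff_singleton_lt_of_mem hs.mem (Set.toFinite S))
      (S \ {s}) rfl ⟨hx, hsx.symm⟩ ⟨hy, hsy.symm⟩
    obtain ⟨g, hg, hgf, hgs⟩ := hs.exists_isExt_top hf
    refine ⟨g, hg, fun z hz hzx hzy hlt => ?_, fun z hz hzx hlt => ?_⟩
    · have hzs : z ≠ s := by
        rintro rfl
        exact lt_asymm hlt (hgs y hsy.symm)
      rw [hgf z hzs, hgf y hsy.symm] at hlt
      rw [hgf z hzs, hgf x hsx.symm]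
      exact h1 z ⟨hz, hzs⟩ hzx hzy hlt
    · have hzs : z ≠ s := by
        rintro rfl
        exact lt_asymm hlt (hgs x hsx.symm)
      rw [hgf z hzs, hgf x hsx.symm] at hlt
      exact h2 z ⟨hz, hzs⟩ hzx hlt
  push Not at h0
  -- Now `y` is the only terminal vertex, hence last on `S` in every extension, and maximal
  -- orientation forces all edges at `y` to be directed into it.
  have hpar : ∀ z ∈ S, H.skeleton.Adj z y → H.dir z y := by
    intro z hz hzy
    have key : ∀ f, H.IsExt Set.univ f → f z ≤ f y := by
      intro f hf
      obtain ⟨s, hs, hmax⟩ := (hf.mono (Set.subset_univ S)).exists_isTerminal ⟨y, hy⟩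
      rw [← h0 s hs]
      exact hmax z hz
    rcases hzy with h | h | h
    · exact h
    · obtain ⟨f, hf⟩ := hH.exists_isExt
      exact absurd (hf.dir_lt y trivial z trivial h) (not_lt.2 (key f hf))
    · obtain ⟨f, hf, hlt⟩ := hH.exists_of_undir y z (H.undir_symm _ _ h)
      exact absurd hlt (not_lt.2 (key f hf))
  simp only [MStronglyProtected, hxy, true_and, not_or, not_exists, not_and, not_not] at hunp
  obtain ⟨ha, hb, hc, hd, he⟩ := hunp
  -- The parents of `x` among its undirected neighbours must be exactly those that are parents of
  -- `y`. They form a clique by the absence of (d); (e) and `hpar` exclude edges into them from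
  -- other undirected neighbours of `x`.
  obtain ⟨f, hf, hfx⟩ := hH.exists_isExt_of_clique _ S rfl x
    {w | w ∈ S ∧ H.undir x w ∧ H.dir w y} hx (fun w hw => hw.1) (fun w hw => hw.2.1)
    (fun v hv w hw hne => hd v w hne hv.2.1 hw.2.1 hv.2.2 hw.2.2)
    (fun u hu hxu huW w hw huw => huW ⟨hu, hxu, hpar u hu (he u w hxu hw.2.1 huw hw.2.2)⟩)
  refine ⟨f, hf, fun z hz hzx hzy _ => ?_, fun z hz hzx hlt => ?_⟩
  · have hzy' := hpar z hz hzy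
    have hadj := hb z hzx hzy'
    refine ⟨hadj, ?_⟩
    rcases hadj with h | h | h
    · exact hf.dir_lt z hz x hx h
    · exact absurd hzy' (hc z h)
    · have h' := H.undir_symm _ _ h
      exact (hfx z hz h').2 ⟨hz, h', hzy'⟩
  · rcases hzx with h | h | h
    · exact ha z h
    · exact absurd hlt (lt_asymm (hf.dir_lt x hx z hz h))
    · exact adj_of_dir ((hfx z hz (H.undir_symm _ _ h)).1 hlt).2.2

/-! ### CPDAGs -/

theorem SameSkeletonAndVStructures.symm (h : G.SameSkeletonAndVStructures G') :
    G'.SameSkeletonAndVStructures G :=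
  ⟨h.1.symm, fun x y z => (h.2 x y z).symm⟩

theorem SameSkeletonAndVStructures.trans (h : G.SameSkeletonAndVStructures G')
    (h' : G'.SameSkeletonAndVStructures H) : G.SameSkeletonAndVStructures H :=
  ⟨h.1.trans h'.1, fun x y z => (h.2 x y z).trans (h'.2 x y z)⟩

theorem IsCPDAGOf.sameSkeletonAndVStructures (h : C.IsCPDAGOf G) (hG : G.IsDAG) :
    C.SameSkeletonAndVStructures G := by
  obtain ⟨-, hs, hd⟩ := h
  refine ⟨hs, fun x y z => ⟨fun hv => ?_, fun hv => ?_⟩⟩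
  · exact ⟨hv.1, (hd x y).1 hv.2.1 G hG (.refl G), (hd z y).1 hv.2.2.1 G hG (.refl G),
      hs ▸ hv.2.2.2⟩
  · exact ⟨hv.1, (hd x y).2 fun G' hG' h => (h.symm.isVStructure hG hG' hv).2.1,
      (hd z y).2 fun G' hG' h => (h.symm.isVStructure hG hG' hv).2.2.1, hs ▸ hv.2.2.2⟩

/-- This replaces d-separation by skeleton and v-structures, via the Verma–Pearl criterion. -/
theorem IsCPDAG.mem_markovClass_iff [Finite V] (hC : C.IsCPDAG) :
    D ∈ C.markovClass ↔ D.IsDAG ∧ D.SameSkeletonAndVStructures C := by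
  constructor
  · rintro ⟨hD, G, hG, hCG, hDG⟩
    exact ⟨hD, (hDG.sameSkeletonAndVStructures hD hG).trans
      (hCG.sameSkeletonAndVStructures hG).symm⟩
  · rintro ⟨hD, hDC⟩
    obtain ⟨G, hG, hCG⟩ := hC
    exact ⟨hD, G, hG, hCG,
      (hDC.trans (hCG.sameSkeletonAndVStructures hG)).markovEquivalent hD hG⟩

theorem undir_iff (G : PDGraph V) (x y : V) :
    G.undir x y ↔ G.skeleton.Adj x y ∧ ¬ G.dir x y ∧ ¬ G.dir y x := by
  constructor
  · exact fun h => ⟨adj_of_undir h, fun h' => G.not_undir_of_dir _ _ h' h,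
      fun h' => G.not_undir_of_dir _ _ h' (G.undir_symm _ _ h)⟩
  · rintro ⟨h | h | h, h1, h2⟩
    · exact absurd h h1
    · exact absurd h h2
    · exact h

theorem IsCPDAG.eq_of_sameSkeletonAndVStructures [Finite V] (hC : C.IsCPDAG) (hC' : C'.IsCPDAG)
    (h : C.SameSkeletonAndVStructures C') : C = C' := by
  obtain ⟨G, hG, hCG⟩ := hC
  obtain ⟨G', hG', hCG'⟩ := hC'
  have hGG' : G.MarkovEquivalent G' :=
    (((hCG.sameSkeletonAndVStructures hG).symm.trans h).trans
      (hCG'.sameSkeletonAndVStructures hG')).markovEquivalent hG hG'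
  have hdir : ∀ x y, C.dir x y ↔ C'.dir x y := by
    intro x y
    rw [hCG.2.2, hCG'.2.2]
    exact forall₂_congr fun D _ => imp_congr_left
      ⟨fun hD => hD.trans hGG', fun hD => hD.trans hGG'.symm⟩
  apply PDGraph.ext
  · funext x y
    exact propext (hdir x y)
  · funext x y
    rw [undir_iff, undir_iff, h.1, hdir, hdir]

/-! ### Causal MPDAGs -/

theorem IsUnderlyingCPDAG.sameSkeletonAndVStructures (h : C.IsUnderlyingCPDAG H) :
    H.SameSkeletonAndVStructures C := by
  obtain ⟨-, B, hB⟩ := h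
  exact hB.2.2.1

theorem IsUnderlyingCPDAG.unique [Finite V] (h : C.IsUnderlyingCPDAG H)
    (h' : C'.IsUnderlyingCPDAG H) : C = C' :=
  h.1.eq_of_sameSkeletonAndVStructures h'.1
    (h.sameSkeletonAndVStructures.symm.trans h'.sameSkeletonAndVStructures)

theorem exists_isExt_of_mem_dagClass [Finite V] (hD : D ∈ H.dagClass) :
    ∃ f, H.IsExt Set.univ f ∧ ∀ a b, D.dir a b → f a < f b := by
  obtain ⟨hD, ⟨hs, hv⟩, hdir⟩ := hD
  obtain ⟨f, hf⟩ := hD.1.exists_rank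
  refine ⟨f, ⟨fun a _ b _ hab => isProper_of_dir_lt hD hf a b (hs ▸ hab),
    fun a _ b _ hab => hf a b (hdir a b hab), ?_⟩, hf⟩
  intro a _ b _ c _ hab hcb hac hn h1 h2
  rw [← hs] at hab hcb hn
  exact ((hv a b c).1 ⟨hac, (dir_iff_of_rank hD hf _ _).2 ⟨hab, h1⟩,
    (dir_iff_of_rank hD hf _ _).2 ⟨hcb, h2⟩, hn⟩).2.1

theorem IsExt.isProper {f : V → ℕ} (hf : H.IsExt Set.univ f) : IsProper H.skeleton f :=
  fun a b => hf.proper a trivial b trivial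

theorem IsExt.isVStructure_iff {f : V → ℕ} (hf : H.IsExt Set.univ f) (a b c : V) :
    H.IsVStructure a b c ↔ a ≠ c ∧ (H.skeleton.Adj a b ∧ f a < f b) ∧
      (H.skeleton.Adj c b ∧ f c < f b) ∧ ¬ H.skeleton.Adj a c := by
  constructor
  · rintro ⟨h1, h2, h3, h4⟩
    exact ⟨h1, ⟨adj_of_dir h2, hf.dir_lt a trivial b trivial h2⟩,
      ⟨adj_of_dir h3, hf.dir_lt c trivial b trivial h3⟩, h4⟩
  · rintro ⟨h1, ⟨h2, h3⟩, ⟨h4, h5⟩, h6⟩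
    exact ⟨h1, hf.dir_of_collider a trivial b trivial c trivial h2 h4 h1 h6 h3 h5,
      hf.dir_of_collider c trivial b trivial a trivial h4 h2 h1.symm (fun h => h6 h.symm) h5 h3, h6⟩

theorem IsExt.sameSkeletonAndVStructures_ofRank {f g : V → ℕ} (hf : H.IsExt Set.univ f)
    (hg : IsProper H.skeleton g) (hfg : SameColliders H.skeleton f g) :
    (ofRank H.skeleton g).SameSkeletonAndVStructures H := by
  refine ⟨skeleton_ofRank hg, fun a b c => ?_⟩
  rw [hf.isVStructure_iff]
  unfold IsVStructure
  rw [skeleton_ofRank hg]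
  have := hfg a b c
  simp only [ofRank]
  tauto

theorem IsExt.ofRank_mem_dagClass {f : V → ℕ} (hf : H.IsExt Set.univ f) :
    ofRank H.skeleton f ∈ H.dagClass :=
  ⟨isDAG_ofRank _ _, hf.sameSkeletonAndVStructures_ofRank hf.isProper fun _ _ _ _ _ _ _ => Iff.rfl,
    fun x y h => ⟨adj_of_dir h, hf.dir_lt x trivial y trivial h⟩⟩

/-- Beyond skeleton and v-structures, this is all that is used of the constraints: if `b → a` is not
in `H`, some DAG of the restricted class lacks it, and that DAG lies in `[H]`. -/
theorem IsUnderlyingCPDAG.isMaximallyOriented [Finite V] (h : C.IsUnderlyingCPDAG H) :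
    H.IsMaximallyOriented := by
  obtain ⟨hC, B, hne, -, hHC, hdir⟩ := h
  have hsub : ∀ D ∈ C.restrictedClass B, D ∈ H.dagClass := by
    intro D hD
    obtain ⟨hD1, hD2⟩ := hC.mem_markovClass_iff.1 hD.1
    exact ⟨hD1, hD2.trans hHC.symm, fun x y hxy => (hdir x y).1 hxy D hD⟩
  constructor
  · obtain ⟨D, hD⟩ := hne
    obtain ⟨f, hf, -⟩ := exists_isExt_of_mem_dagClass (hsub D hD)
    exact ⟨f, hf⟩
  · intro a b hab
    have hba := H.undir_symm _ _ hab
    have : ¬ H.dir b a := fun h => H.not_undir_of_dir _ _ h hba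
    rw [hdir] at this
    push Not at this
    obtain ⟨D, hD, hDba⟩ := this
    have hD' := hsub D hD
    obtain ⟨f, hf, hfD⟩ := exists_isExt_of_mem_dagClass hD'
    refine ⟨f, hf, hfD a b ((hD'.1.dir_or_dir ?_).resolve_right hDba)⟩
    rw [hD'.2.1.1]
    exact adj_of_undir hab

/-! ### Generators -/

theorem dagClass_eq_restrictedClass_iff [Finite V] (hC : C.IsCPDAG)
    (hHC : H.SameSkeletonAndVStructures C) (A : Set (V × V)) :
    H.dagClass = C.restrictedClass (directConstraints A) ↔
      ∀ D : PDGraph V, D.IsDAG → D.SameSkeletonAndVStructures H →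
        ((∀ x y, H.dir x y → D.dir x y) ↔ ∀ e ∈ A, D.dir e.1 e.2) := by
  have hsat : ∀ D : PDGraph V, (∀ c ∈ directConstraints A, D.Satisfies c) ↔
      ∀ e ∈ A, D.dir e.1 e.2 := by
    intro D
    exact Set.forall_mem_image
  have hmem : ∀ D : PDGraph V, D ∈ C.restrictedClass (directConstraints A) ↔
      (D.IsDAG ∧ D.SameSkeletonAndVStructures H) ∧ ∀ e ∈ A, D.dir e.1 e.2 := by
    intro D
    rw [restrictedClass, Set.mem_ofPred_eq, hC.mem_markovClass_iff, hsat]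
    exact and_congr_left' (and_congr_right' ⟨fun h => h.trans hHC.symm, fun h => h.trans hHC⟩)
  rw [Set.ext_iff]
  refine forall_congr' fun D => ?_
  rw [hmem, dagClass, Set.mem_ofPred_eq]
  tauto

theorem IsUnderlyingCPDAG.isGenerator_iff [Finite V] (hC : C.IsUnderlyingCPDAG H)
    (A : Set (V × V)) :
    H.IsGenerator A ↔ ∀ D : PDGraph V, D.IsDAG → D.SameSkeletonAndVStructures H →
      ((∀ x y, H.dir x y → D.dir x y) ↔ ∀ e ∈ A, D.dir e.1 e.2) := by
  rw [← dagClass_eq_restrictedClass_iff hC.1 hC.sameSkeletonAndVStructures]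
  constructor
  · rintro ⟨C', hC', h⟩
    rwa [hC.unique hC']
  · exact fun h => ⟨C, hC, h⟩

/-- The directed edges that are not M-strongly protected. -/
def unprotectedEdges (H : PDGraph V) : Set (V × V) :=
  {e | H.dir e.1 e.2 ∧ ¬ H.MStronglyProtected e.1 e.2}

/-- Among the edges of `H` that `D` reverses, take one with lowest head `y` and then highest tail
`x`. Directed edges of `H` into vertices before `y`, or into `y` from vertices after `x`, are then
right in `D`. With `y → x` in `D`, configurations (a) and (b) contradict the equality of
v-structures, (c) gives a cycle, and in (d) and (e) avoiding cycles forces a collider at `x` on an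
edge that is undirected in `H`. -/
theorem IsMaximallyOriented.dir_of_unprotectedEdges [Finite V] (hH : H.IsMaximallyOriented)
    (hD : D.IsDAG) (hDH : D.SameSkeletonAndVStructures H)
    (hU : ∀ e ∈ H.unprotectedEdges, D.dir e.1 e.2) (x y : V) (hxy : H.dir x y) : D.dir x y := by
  by_contra hn
  obtain ⟨f, hf⟩ := hH.exists_isExt
  have hlt : ∀ a b, H.dir a b → f a < f b := fun a b => hf.dir_lt a trivial b trivial
  have hor : ∀ {a b}, H.skeleton.Adj a b → D.dir a b ∨ D.dir b a :=
    fun h => hD.dir_or_dir (hDH.1 ▸ h)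
  have hno : ∀ {a b c}, H.undir b a → D.dir a b → D.dir c b → a ≠ c → H.skeleton.Adj a c := by
    intro a b c hba hab hcb hac
    by_contra hadj
    have := ((hDH.2 a b c).1 ⟨hac, hab, hcb, hDH.1 ▸ hadj⟩).2.1
    exact H.not_undir_of_dir _ _ this (H.undir_symm _ _ hba)
  obtain ⟨y, ⟨x₀, hx₀⟩, hmin⟩ := Set.exists_min_image {y | ∃ x, H.dir x y ∧ ¬ D.dir x y} f
    (Set.toFinite _) ⟨y, x, hxy, hn⟩
  obtain ⟨x, ⟨hxy, hnxy⟩, hmax⟩ := Set.exists_max_image {x | H.dir x y ∧ ¬ D.dir x y} f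
    (Set.toFinite _) ⟨x₀, hx₀⟩
  have hearly : ∀ {a b}, H.dir a b → f b < f y → D.dir a b := by
    intro a b hab hb
    by_contra h
    exact absurd (hmin b ⟨a, hab, h⟩) (not_le.2 hb)
  have hyx := (hor (adj_of_dir hxy)).resolve_left hnxy
  by_cases hp : H.MStronglyProtected x y
  swap
  · exact hnxy (hU (x, y) ⟨hxy, hp⟩)
  rcases hp.2 with ⟨w, hwx, hwy⟩ | ⟨w, hwx, hwy, hadj⟩ | ⟨w, hxw, hwy⟩ |
    ⟨w, z, hwz, hxw, hxz, hwy, hzy, hadj⟩ | ⟨w, z, hxw, hxz, hwz, hzy, hadj⟩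
  · have hne : w ≠ y := by
      rintro rfl
      exact H.dir_asymm _ _ hwx hxy
    have := ((hDH.2 w x y).1 ⟨hne, hearly hwx (hlt _ _ hxy), hyx, hDH.1 ▸ hwy⟩).2.2.1
    exact H.dir_asymm _ _ this hxy
  · exact hnxy ((hDH.2 x y w).2 ⟨hwx.symm, hxy, hwy, fun h => hadj h.symm⟩).2.1
  · have hDwy : D.dir w y := by
      by_contra h
      exact absurd (hmax w ⟨hwy, h⟩) (not_le.2 (hlt _ _ hxw))
    exact hD.1 x (((Relation.TransGen.single (hearly hxw (hlt _ _ hwy))).tail hDwy).tail hyx)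
  · have hv := (hDH.2 w y z).2 ⟨hwz, hwy, hzy, hadj⟩
    have hin : ∀ {u}, H.undir x u → D.dir u y → D.dir u x := by
      intro u hxu huy
      refine (hor (adj_of_undir hxu)).resolve_left fun h => ?_
      exact hD.1 x (((Relation.TransGen.single h).tail huy).tail hyx)
    exact hadj (hno hxw (hin hxw hv.2.1) (hin hxz hv.2.2.1) hwz)
  · have hwy : w ≠ y := by
      rintro rfl
      exact H.dir_asymm _ _ hwz hzy
    have hDwz := hearly hwz (hlt _ _ hzy)
    have hDzy : D.dir z y := by
      refine (hor (adj_of_dir hzy)).resolve_right fun h => ?_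
      have := ((hDH.2 w z y).1 ⟨hwy, hDwz, h, hDH.1 ▸ hadj⟩).2.2.1
      exact H.dir_asymm _ _ this hzy
    have hDwx : D.dir w x := by
      refine (hor (adj_of_undir hxw)).resolve_left fun h => ?_
      exact hD.1 x ((((Relation.TransGen.single h).tail hDwz).tail hDzy).tail hyx)
    exact hadj (hno hxw hDwx hyx hwy)

theorem IsUnderlyingCPDAG.isGenerator_unprotectedEdges [Finite V] (hC : C.IsUnderlyingCPDAG H) :
    H.IsGenerator H.unprotectedEdges :=
  (hC.isGenerator_iff _).2 fun _ hD hDH => ⟨fun h e he => h e.1 e.2 he.1,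
    hC.isMaximallyOriented.dir_of_unprotectedEdges hD hDH⟩

/-- All DAGs of `[H]` satisfy `A`, whereas an undirected edge takes both directions in `[H]`. -/
theorem IsUnderlyingCPDAG.dir_of_mem_isGenerator [Finite V] (hC : C.IsUnderlyingCPDAG H)
    {A : Set (V × V)} (hA : H.IsGenerator A) {e : V × V} (he : e ∈ A) : H.dir e.1 e.2 := by
  have hH := hC.isMaximallyOriented
  have key : ∀ f, H.IsExt Set.univ f → H.skeleton.Adj e.1 e.2 ∧ f e.1 < f e.2 := by
    intro f hf
    obtain ⟨h1, h2, h3⟩ := hf.ofRank_mem_dagClass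
    exact ((hC.isGenerator_iff A).1 hA _ h1 h2).1 h3 e he
  obtain ⟨f, hf⟩ := hH.exists_isExt
  rcases (key f hf).1 with h | h | h
  · exact h
  · exact absurd (key f hf).2 (lt_asymm (hf.dir_lt _ trivial _ trivial h))
  · obtain ⟨g, hg, hlt⟩ := hH.exists_of_undir _ _ (H.undir_symm _ _ h)
    exact absurd (key g hg).2 (lt_asymm hlt)

/-- Reverse the edge in a DAG of `[H]` where it is covered. If `A` omitted it, the new DAG would
still satisfy `A`, whose elements are directed edges of `H`, and so would have to contain the edge
just reversed. -/
theorem IsUnderlyingCPDAG.unprotectedEdges_subset [Finite V] (hC : C.IsUnderlyingCPDAG H)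
    {A : Set (V × V)} (hA : H.IsGenerator A) : H.unprotectedEdges ⊆ A := by
  rintro ⟨x, y⟩ ⟨hxy, hunp⟩
  by_contra he
  obtain ⟨f, hf, h1, h2⟩ := hC.isMaximallyOriented.exists_isExt_isCovered hxy hunp _ Set.univ rfl
    trivial trivial
  have hcov : IsCovered H.skeleton f x y := ⟨adj_of_dir hxy, hf.dir_lt _ trivial _ trivial hxy,
    fun z => h1 z trivial, fun z => h2 z trivial⟩
  have hg := hcov.isProper_flipRank hf.isProper
  have hD := ((hC.isGenerator_iff A).1 hA _ (isDAG_ofRank _ _)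
    (hf.sameSkeletonAndVStructures_ofRank hg (hcov.sameColliders_flipRank hf.isProper))).2 ?_
  · rcases (hcov.flipRank_lt_iff hf.isProper hcov.adj).1 (hD x y hxy).2 with h | h
    · exact h.2 ⟨rfl, rfl⟩
    · exact hcov.adj.ne h.1
  · intro e heA
    have hdir := hC.dir_of_mem_isGenerator hA heA
    refine ⟨adj_of_dir hdir, (hcov.flipRank_lt_iff hf.isProper (adj_of_dir hdir)).2
      (Or.inl ⟨hf.dir_lt _ trivial _ trivial hdir, ?_⟩)⟩
    rintro ⟨rfl, rfl⟩
    exact he heA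

theorem IsUnderlyingCPDAG.isMinimalGenerator_iff [Finite V] (hC : C.IsUnderlyingCPDAG H)
    (A : Set (V × V)) : H.IsMinimalGenerator A ↔ A = H.unprotectedEdges := by
  constructor
  · rintro ⟨hA, hmin⟩
    exact ((Set.toFinite _).eq_of_subset_of_encard_le (hC.unprotectedEdges_subset hA)
      (hmin _ hC.isGenerator_unprotectedEdges)).symm
  · rintro rfl
    exact ⟨hC.isGenerator_unprotectedEdges,
      fun A' hA' => Set.encard_le_encard (hC.unprotectedEdges_subset hA')⟩

end PDGraph

theorem mainTheorem6 {V : Type*} [Finite V] (H : PDGraph V) (hH : H.IsCausalMPDAG) :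
    (∃! C : PDGraph V, C.IsUnderlyingCPDAG H) ∧
    (∃! p : PDGraph V × Set (V × V), p.1.IsCPDAG ∧ H.IsMinimalGenerator p.2 ∧
      H.dagClass = p.1.restrictedClass (PDGraph.directConstraints p.2)) ∧
    (∃! A : Set (V × V), H.IsMinimalGenerator A) ∧
    (∀ A : Set (V × V), H.IsMinimalGenerator A ↔
      A = {e : V × V | H.dir e.1 e.2 ∧ ¬ H.MStronglyProtected e.1 e.2}) := by
  obtain ⟨C, hC⟩ := hH
  have hmin := hC.isMinimalGenerator_iff
  refine ⟨⟨C, hC, fun C' hC' => hC'.unique hC⟩, ⟨(C, H.unprotectedEdges), ?_, ?_⟩,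
    ⟨H.unprotectedEdges, (hmin _).2 rfl, fun A hA => (hmin A).1 hA⟩, hmin⟩
  · exact ⟨hC.1, (hmin _).2 rfl,
      (PDGraph.dagClass_eq_restrictedClass_iff hC.1 hC.sameSkeletonAndVStructures _).2
        ((hC.isGenerator_iff _).1 hC.isGenerator_unprotectedEdges)⟩
  · rintro ⟨C', A⟩ ⟨hC', hA, hcl⟩
    simp only at hC' hA hcl
    -- A single DAG in the common class ties the skeleton and v-structures of `C'` to those of `H`,
    -- hence `C' = C`.
    obtain ⟨f, hf⟩ := hC.isMaximallyOriented.exists_isExt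
    have hD := hf.ofRank_mem_dagClass
    have hDC' := (hC'.mem_markovClass_iff.1 (hcl ▸ hD).1).2
    rw [(hmin A).1 hA, hC'.eq_of_sameSkeletonAndVStructures hC.1
      ((hDC'.symm.trans hD.2.1).trans hC.sameSkeletonAndVStructures)]
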